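/- All graphs are finite, undirected and simple; $n$ and $m$ are the numbers of vertices and edges, and $\delta(G)$ is the minimum degree. A vertex dominates itself and its neighbours. An efficient dominating set (e.d.) of $G$ is a set $D$ of vertices such that every vertex of $G$ is dominated by exactly one vertex of $D$. The problem WED asks, for $G$ with vertex weights $\omega:V\to\mathbb N$, for an e.d. of minimum total weight, or for the answer that $G$ has no e.d. $P_6$ is the path with six vertices, and $S_{1,2,2}$ is the tree with one vertex of degree $3$ and three leaves at distances $1,2,2$ from it. A graph is $(P_6,S_{1,2,2})$-free if it has no induced subgraph isomorphic to $P_6$ or $S_{1,2,2}$. For a vertex $v$ of a connected graph $G$ let $N_i=\{x : \mathrm{dist}(v,x)=i\}$ and $G_v=G[V\setminus(\{v\}\cup N_1)]$. A graph is prime if it has no homogeneous set, i.e. no set $H\neq V$ of at least two vertices such that every vertex outside $H$ is adjacent to all or to none of the vertices of $H$. Running times are those of a random access machine with adjacency-list input, on which addition, truncated subtraction and comparison of natural numbers and memory access take unit time. (a) Let $G$ be a connected $(P_6,S_{1,2,2})$-free graph, $v$ a vertex and $D$ an e.d. of $G$ with $v\in D$. Then $D\cap N_4=\emptyset$, and every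 connected component of $G[N_3]$ contains exactly one vertex of $D$. Moreover, let $S\subseteq N_2\cup N_3\cup N_4$ with $D\setminus\{v\}\subseteq S$ be such that $G[S]$ is prime, every vertex of $S\cap N_3$ is adjacent to all or to none of the vertices of $S\cap N_4$, and every component of $G[S\cap N_3]$ is a clique. Then at most one component of $G[S\cap N_3]$ has more than one vertex. (b) There is an algorithm which, for every connected graph $G$, every vertex $v$ and all vertex weights $w:V\to\mathbb N\cup\{\infty\}$ with $w=\infty$ on $N_2\cup N_4$, runs in time $O(m)$ and either returns an e.d. of $G_v$ of finite weight, or reports failure; if it fails, then $G$ is not $(P_6,S_{1,2,2})$-free or $G_v$ has no e.d. of finite weight. If $G$ is $(P_6,S_{1,2,2})$-free, then a returned e.d. of $G_v$ has minimum weight. (c) WED is solvable in time $O(\delta(G)\cdot m)$ on connected $(P_6,S_{1,2,2})$-free graphs. (If $G$ has only one vertex, the bounds in (b) and (c) are to be read as $O(1)$.) -/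

import Mathlib

namespace WED

/-! ## Graphs -/

section Graphs

variable {V : Type*}

/-- `D` is an efficient dominating set (e.d.) of `G`: every vertex is dominated by exactly one
vertex of `D`, where a vertex dominates itself and its neighbours. -/
def IsED (G : SimpleGraph V) (D : Set V) : Prop :=
  ∀ x, ∃! d, d ∈ D ∧ (d = x ∨ G.Adj d x)

/-- The total weight of a finite vertex set, with values in `ℕ ∪ {∞}`. -/
def weight (w : V → ℕ∞) (D : Finset V) : ℕ∞ := ∑ x ∈ D, w x

/-- `D` is an e.d. of `G` of minimum weight. -/
def IsMinED (G : SimpleGraph V) (w : V → ℕ∞) (D : Finset V) : Prop :=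
  IsED G (D : Set V) ∧ ∀ D' : Finset V, IsED G (D' : Set V) → weight w D ≤ weight w D'

/-- The tree `S_{1,2,2}`: centre `0`, with the three legs `1`, `2 – 3` and `4 – 5`. -/
def S122 : SimpleGraph (Fin 6) :=
  SimpleGraph.fromEdgeSet {s(0, 1), s(0, 2), s(2, 3), s(0, 4), s(4, 5)}

/-- `G` contains neither `P_6` (the path with six vertices) nor `S_{1,2,2}` as an induced
subgraph. -/
def P6S122Free (G : SimpleGraph V) : Prop :=
  ¬ (SimpleGraph.pathGraph 6).IsIndContained G ∧ ¬ S122.IsIndContained G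

/-- The distance level `N_i(v)`. -/
def level (G : SimpleGraph V) (v : V) (i : ℕ) : Set V := {x | G.dist v x = i}

/-- The vertex set `V \ ({v} ∪ N_1(v))` of the graph `G_v`. -/
def farSet (G : SimpleGraph V) (v : V) : Set V := {x | x ≠ v ∧ ¬ G.Adj v x}

/-- A homogeneous set: at least two vertices, not all vertices, and every outside vertex is adjacent
to all or to none of its vertices. -/
def IsHomogeneous (G : SimpleGraph V) (H : Set V) : Prop :=
  H.Nontrivial ∧ H ≠ Set.univ ∧ ∀ x, x ∉ H → (∀ h ∈ H, G.Adj x h) ∨ (∀ h ∈ H, ¬ G.Adj x h)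

/-- A graph without homogeneous sets. -/
def IsPrimeGraph (G : SimpleGraph V) : Prop := ∀ H : Set V, ¬ IsHomogeneous G H

end Graphs

/-! ## Programs on a unit-cost random access machine

A program works on natural-number variables and on zero-based unbounded arrays of natural numbers.
Addition, truncated subtraction, indexed reading and writing and tests cost one time unit each. -/

/-- The memory: scalar variables `var x` and arrays `arr a`, both named by natural numbers. -/
structure State where
  var : ℕ → ℕ
  arr : ℕ → ℕ → ℕ

/-- Expressions; `read a e` is the entry of array `a` at the index given by `e`. -/
inductive Expr : Type
  | const (c : ℕ)
  | var (x : ℕ)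
  | read (a : ℕ) (e : Expr)
  | add (e f : Expr)
  | sub (e f : Expr)

/-- The value of an expression. -/
def Expr.eval (s : State) : Expr → ℕ
  | .const c => c
  | .var x => s.var x
  | .read a e => s.arr a (e.eval s)
  | .add e f => e.eval s + f.eval s
  | .sub e f => e.eval s - f.eval s

/-- The time to evaluate an expression: one unit per node. -/
def Expr.cost : Expr → ℕ
  | .const _ => 1
  | .var _ => 1
  | .read _ e => e.cost + 1
  | .add e f => e.cost + f.cost + 1
  | .sub e f => e.cost + f.cost + 1

/-- Programs. A test `e` counts as true when its value is not `0`. -/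
inductive Prog : Type
  | skip
  | assign (x : ℕ) (e : Expr)
  | write (a : ℕ) (i e : Expr)
  | seq (p q : Prog)
  | ite (e : Expr) (p q : Prog)
  | while (e : Expr) (p : Prog)

/-- The state after the assignment `x := k`. -/
def State.setVar (s : State) (x k : ℕ) : State :=
  { s with var := Function.update s.var x k }

/-- The state after the assignment `a[i] := k`. -/
def State.setArr (s : State) (a i k : ℕ) : State :=
  { s with arr := Function.update s.arr a (Function.update (s.arr a) i k) }

/-- `Exec p s s' t`: started in `s`, the program `p` halts in `s'` after exactly `t` time units. -/
inductive Exec : Prog → State → State → ℕ → Prop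
  | skip (s : State) : Exec .skip s s 1
  | assign (s : State) (x : ℕ) (e : Expr) :
      Exec (.assign x e) s (s.setVar x (e.eval s)) (e.cost + 1)
  | write (s : State) (a : ℕ) (i e : Expr) :
      Exec (.write a i e) s (s.setArr a (i.eval s) (e.eval s)) (i.cost + e.cost + 1)
  | seq {p q : Prog} {s₁ s₂ s₃ : State} {t u : ℕ} :
      Exec p s₁ s₂ t → Exec q s₂ s₃ u → Exec (.seq p q) s₁ s₃ (t + u)
  | iteTrue {e : Expr} {p q : Prog} {s₁ s₂ : State} {t : ℕ} :
      e.eval s₁ ≠ 0 → Exec p s₁ s₂ t → Exec (.ite e p q) s₁ s₂ (e.cost + 1 + t)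
  | iteFalse {e : Expr} {p q : Prog} {s₁ s₂ : State} {t : ℕ} :
      e.eval s₁ = 0 → Exec q s₁ s₂ t → Exec (.ite e p q) s₁ s₂ (e.cost + 1 + t)
  | whileTrue {e : Expr} {p : Prog} {s₁ s₂ s₃ : State} {t u : ℕ} :
      e.eval s₁ ≠ 0 → Exec p s₁ s₂ t → Exec (.while e p) s₂ s₃ u →
      Exec (.while e p) s₁ s₃ (e.cost + 1 + t + u)
  | whileFalse {e : Expr} {p : Prog} {s : State} :
      e.eval s = 0 → Exec (.while e p) s s (e.cost + 1)

/-- Programs are deterministic: the final state and the running time are unique. -/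
theorem Exec.deterministic {p : Prog} {s s₁ s₂ : State} {t₁ t₂ : ℕ}
    (h₁ : Exec p s s₁ t₁) (h₂ : Exec p s s₂ t₂) : s₁ = s₂ ∧ t₁ = t₂ := by
  induction h₁ generalizing s₂ t₂ with
  | skip s => cases h₂; exact ⟨rfl, rfl⟩
  | assign s x e => cases h₂; exact ⟨rfl, rfl⟩
  | write s a i e => cases h₂; exact ⟨rfl, rfl⟩
  | seq _ _ ih₁ ih₂ =>
    cases h₂ with
    | seq k₁ k₂ =>
      obtain ⟨rfl, rfl⟩ := ih₁ k₁
      obtain ⟨rfl, rfl⟩ := ih₂ k₂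
      exact ⟨rfl, rfl⟩
  | iteTrue he _ ih =>
    cases h₂ with
    | iteTrue _ k => obtain ⟨rfl, rfl⟩ := ih k; exact ⟨rfl, rfl⟩
    | iteFalse he' _ => exact absurd he' he
  | iteFalse he _ ih =>
    cases h₂ with
    | iteTrue he' _ => exact absurd he he'
    | iteFalse _ k => obtain ⟨rfl, rfl⟩ := ih k; exact ⟨rfl, rfl⟩
  | whileTrue he _ _ ih₁ ih₂ =>
    cases h₂ with
    | whileTrue _ k₁ k₂ =>
      obtain ⟨rfl, rfl⟩ := ih₁ k₁
      obtain ⟨rfl, rfl⟩ := ih₂ k₂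
      exact ⟨rfl, rfl⟩
    | whileFalse he' => exact absurd he' he
  | whileFalse he =>
    cases h₂ with
    | whileTrue he' _ _ => exact absurd he he'
    | whileFalse _ => exact ⟨rfl, rfl⟩

/-! ## Input and output -/

/-- Adjacency lists of a graph: each neighbour is listed exactly once, in any order. -/
structure AdjLists {n : ℕ} (G : SimpleGraph (Fin n)) where
  nbrs : Fin n → List (Fin n)
  nodup : ∀ v, (nbrs v).Nodup
  mem_iff : ∀ v x, x ∈ nbrs v ↔ G.Adj v x

/-- The concatenation of the adjacency lists of the vertices `0, 1, …, n - 1`. -/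
def AdjLists.concat {n : ℕ} {G : SimpleGraph (Fin n)} (L : AdjLists G) : List ℕ :=
  (List.finRange n).flatMap fun u => (L.nbrs u).map Fin.val

/-- The position in the concatenation at which the adjacency list of vertex `i` starts; for `i = n`
it is the total length. -/
def AdjLists.offset {n : ℕ} {G : SimpleGraph (Fin n)} (L : AdjLists G) (i : ℕ) : ℕ :=
  ∑ u : Fin n with u.val < i, (L.nbrs u).length

/-- Weights are stored as numbers: `∞` as `0`, and a finite weight `k` as `k + 1`. -/
def encodeWeight : ℕ∞ → ℕ
  | ⊤ => 0
  | (k : ℕ) => k + 1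

/-- The initial memory: variable `0` holds the number of vertices, variable `1` the number `v`,
array `0` the weights, array `1` the `n + 1` offsets and array `2` the concatenated adjacency lists;
everything else is zero. -/
def input {n : ℕ} {G : SimpleGraph (Fin n)} (L : AdjLists G) (w : Fin n → ℕ∞) (v : ℕ) : State where
  var x := if x = 0 then n else if x = 1 then v else 0
  arr a i :=
    if a = 0 then (if h : i < n then encodeWeight (w ⟨i, h⟩) else 0)
    else if a = 1 then (if i ≤ n then L.offset i else 0)
    else if a = 2 then L.concat.getD i 0
    else 0

/-- The answer given by a final memory: variable `2` is nonzero iff a vertex set is returned. -/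
def State.found (s : State) : Prop := s.var 2 ≠ 0

/-- The returned vertex set: array `3` is its indicator (nonzero means membership). -/
def State.outSet (s : State) (n : ℕ) : Finset (Fin n) :=
  Finset.univ.filter fun x => s.arr 3 x.val ≠ 0

end WED

/-! Forbidding $P_6$ and $S_{1,2,2}$ enters mainly through one exchange fact. If $v\in D$, the rest
of $D$ lies in $N_3$ and dominates every vertex at distance at least two from $v$ exactly once
(`IsFarED`). If $x\in N_3$ is dominated by $d\in D$, then so are all neighbours of $x$
(`IsFarED.eq_of_adj`): a second dominator, together with a path back to $v$, would produce a
forbidden subgraph. In other words $N[x]\subseteq N[d]$.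

For (a), this makes the dominator constant on each component of $G[N_3]$, so each component contains
one vertex of $D$, universal in it. In a prime $G[S]$, each of two nontrivial components with
centres $d,d'$ would be split by a vertex of $N_2\cup N_4$ adjacent to its centre. A splitter in
$N_2$ leads to an induced $P_6$ (`IsFarED.not_two_separators`); two splitters in $N_4$ would have to
share both dominators, by the join condition.

For (b), the inclusion $N[x]\subseteq N[d]$ turns degree into a test: inside $N[d]$, the vertices of
$N_3$ with the degree of $d$ are exactly its true twins, and all others have smaller degree. Hence
the local optima for "large degree, small weight, small number" (`selection`), defined without $D$,
pick exactly one cheapest finite-weight twin of each $d$. If any far e.d. of finite weight exists,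
the selection is one of minimum weight (`IsFarED.isFarED_selection`, `IsFarED.weight_selection_le`).
The program computes the selection and then verifies it. The verification is exact on every
connected graph, which gives robustness.

For (c), some vertex of $N[u]$ belongs to $D$, where $u$ has minimum degree, so $\delta(G)+1$ runs
of (b) suffice. On the machine every stage is a constant number of sweeps over the adjacency lists
(`runs_pass`) or over the vertices, and connectedness gives $n\le m+1$. -/

namespace WED

/-! ### Efficient dominating sets and distance levels -/

section Structure

variable {V : Type*} {G : SimpleGraph V}

/-- Distinctness of the six vertices need not be assumed: no two vertices of $P_6$ have the same
neighbourhood, so the adjacency pattern already forces injectivity. The same holds for $S_{1,2,2}$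
below. -/
theorem P6S122Free.not_path (hG : P6S122Free G) {a b c d e f : V}
    (ab : G.Adj a b) (bc : G.Adj b c) (cd : G.Adj c d) (de : G.Adj d e) (ef : G.Adj e f)
    (ac : ¬ G.Adj a c) (ad : ¬ G.Adj a d) (ae : ¬ G.Adj a e) (af : ¬ G.Adj a f)
    (bd : ¬ G.Adj b d) (be : ¬ G.Adj b e) (bf : ¬ G.Adj b f)
    (ce : ¬ G.Adj c e) (cf : ¬ G.Adj c f) (df : ¬ G.Adj d f) : False := by
  have key : ∀ i j : Fin 6, G.Adj (![a, b, c, d, e, f] i) (![a, b, c, d, e, f] j) ↔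
      (SimpleGraph.pathGraph 6).Adj i j := by
    intro i j
    rw [SimpleGraph.pathGraph_adj]
    fin_cases i <;> fin_cases j <;>
      simp [ab, bc, cd, de, ef, ac, ad, ae, af, bd, be, bf, ce, cf, df, G.adj_comm b a,
        G.adj_comm c, G.adj_comm d a, G.adj_comm d b, G.adj_comm d c, G.adj_comm e a,
        G.adj_comm e b, G.adj_comm e c, G.adj_comm e d, G.adj_comm f]
  refine hG.1 ⟨⟨⟨_, fun i j hij => ?_⟩, fun {i j} => key i j⟩⟩
  have h : ∀ k, (SimpleGraph.pathGraph 6).Adj i k ↔ (SimpleGraph.pathGraph 6).Adj j k := by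
    intro k
    have hij' : ![a, b, c, d, e, f] i = ![a, b, c, d, e, f] j := hij
    rw [← key i k, ← key j k, hij']
  simp only [SimpleGraph.pathGraph_adj] at h
  revert h
  clear hij
  revert i j
  decide

theorem P6S122Free.not_tree (hG : P6S122Free G) {c a b₁ b₂ d₁ d₂ : V}
    (ca : G.Adj c a) (cb : G.Adj c b₁) (bb : G.Adj b₁ b₂) (cd : G.Adj c d₁) (dd : G.Adj d₁ d₂)
    (cb2 : ¬ G.Adj c b₂) (cd2 : ¬ G.Adj c d₂) (ab1 : ¬ G.Adj a b₁) (ab2 : ¬ G.Adj a b₂)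
    (ad1 : ¬ G.Adj a d₁) (ad2 : ¬ G.Adj a d₂) (bd11 : ¬ G.Adj b₁ d₁) (bd12 : ¬ G.Adj b₁ d₂)
    (bd21 : ¬ G.Adj b₂ d₁) (bd22 : ¬ G.Adj b₂ d₂) : False := by
  have key : ∀ i j : Fin 6, G.Adj (![c, a, b₁, b₂, d₁, d₂] i) (![c, a, b₁, b₂, d₁, d₂] j) ↔
      S122.Adj i j := by
    intro i j
    rw [S122, SimpleGraph.fromEdgeSet_adj]
    fin_cases i <;> fin_cases j <;>
      simp [ca, cb, bb, cd, dd, cb2, cd2, ab1, ab2, ad1, ad2, bd11, bd12, bd21, bd22, ca.symm,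
        cb.symm, bb.symm, cd.symm, dd.symm, mt G.adj_symm cb2, mt G.adj_symm cd2, mt G.adj_symm ab1,
        mt G.adj_symm ab2, mt G.adj_symm ad1, mt G.adj_symm ad2, mt G.adj_symm bd11, mt G.adj_symm bd12,
        mt G.adj_symm bd21, mt G.adj_symm bd22]
  refine hG.2 ⟨⟨⟨_, fun i j hij => ?_⟩, fun {i j} => key i j⟩⟩
  have h : ∀ k, S122.Adj i k ↔ S122.Adj j k := by
    intro k
    have hij' : ![c, a, b₁, b₂, d₁, d₂] i = ![c, a, b₁, b₂, d₁, d₂] j := hij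
    rw [← key i k, ← key j k, hij']
  simp only [S122, SimpleGraph.fromEdgeSet_adj, Set.mem_insert_iff, Set.mem_singleton_iff] at h
  revert h
  clear hij
  revert i j
  decide

variable {v : V}

theorem dist_le_succ_of_adj (hc : G.Connected) {x y : V} (h : G.Adj x y) :
    G.dist v y ≤ G.dist v x + 1 := by
  have := hc.dist_triangle (u := v) (v := x) (w := y)
  rwa [SimpleGraph.dist_eq_one_iff_adj.2 h] at this

theorem not_adj_of_dist (hc : G.Connected) (v : V) {x y : V}
    (h : G.dist v x + 2 ≤ G.dist v y ∨ G.dist v y + 2 ≤ G.dist v x) : ¬ G.Adj x y := by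
  intro e
  have h1 := dist_le_succ_of_adj (v := v) hc e
  have h2 := dist_le_succ_of_adj (v := v) hc e.symm
  omega

theorem exists_parent (hc : G.Connected) {x : V} {i : ℕ} (h : G.dist v x = i + 1) :
    ∃ y, G.Adj y x ∧ G.dist v y = i := by
  obtain ⟨p, hp⟩ := hc.exists_walk_length_eq_dist x v
  rw [SimpleGraph.dist_comm, h] at hp
  cases p with
  | nil => simp at hp
  | @cons _ y _ e p =>
    refine ⟨y, e.symm, ?_⟩
    have h1 := dist_le_succ_of_adj (v := v) hc e.symm
    have h2 := SimpleGraph.dist_le p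
    rw [SimpleGraph.dist_comm] at h2
    simp only [SimpleGraph.Walk.length_cons] at hp
    omega

theorem dist_eq_zero (hc : G.Connected) {x : V} : G.dist v x = 0 ↔ x = v := by
  rw [hc.dist_eq_zero_iff, eq_comm]

theorem two_le_dist_iff (hc : G.Connected) {x : V} :
    2 ≤ G.dist v x ↔ x ≠ v ∧ ¬ G.Adj v x := by
  rw [← SimpleGraph.dist_eq_one_iff_adj, ne_eq, ← dist_eq_zero hc (v := v)]
  omega

/-- Every vertex at distance two from `v` starts an induced path with two edges that ends in `v`. -/
theorem exists_middle (hc : G.Connected) {y : V} (h : G.dist v y = 2) :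
    ∃ m, G.Adj m y ∧ G.Adj v m ∧ G.dist v m = 1 := by
  obtain ⟨m, h1, h2⟩ := exists_parent hc h
  exact ⟨m, h1, SimpleGraph.dist_eq_one_iff_adj.1 h2, h2⟩

/-- A shortest path from $v$ to a vertex at distance five is an induced $P_6$. -/
theorem P6S122Free.dist_le_four (hG : P6S122Free G) (hc : G.Connected) (x : V) :
    G.dist v x ≤ 4 := by
  by_contra! hx
  have down : ∀ k, ∀ x, G.dist v x = 5 + k → ∃ y, G.dist v y = 5 := by
    intro k
    induction k with
    | zero => exact fun x hx => ⟨x, hx⟩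
    | succ k ih =>
      intro x hx
      obtain ⟨y, -, hy⟩ := exists_parent hc (i := 5 + k) hx
      exact ih y hy
  obtain ⟨f, hf⟩ := down (G.dist v x - 5) x (by omega)
  obtain ⟨e, fe, he⟩ := exists_parent hc hf
  obtain ⟨d, ed, hd⟩ := exists_parent hc he
  obtain ⟨c, dc, hc'⟩ := exists_parent hc hd
  obtain ⟨b, cb, vb, hb⟩ := exists_middle hc hc'
  have hv : G.dist v v = 0 := SimpleGraph.dist_self
  refine hG.not_path vb cb dc ed fe ?_ ?_ ?_ ?_ ?_ ?_ ?_ ?_ ?_ ?_ <;>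
    exact not_adj_of_dist hc v (by omega)

/-- Every vertex at distance at least two from `v` is dominated by exactly one vertex of `D`, and
all vertices of `D` are at distance three from `v`. -/
def IsFarED (G : SimpleGraph V) (v : V) (D : Set V) : Prop :=
  (∀ d ∈ D, G.dist v d = 3) ∧ ∀ x, 2 ≤ G.dist v x → ∃! d, d ∈ D ∧ (d = x ∨ G.Adj d x)

theorem IsED.eq {D : Set V} (hD : IsED G D) {x d e : V} (hd : d ∈ D) (he : e ∈ D)
    (hdx : d = x ∨ G.Adj d x) (hex : e = x ∨ G.Adj e x) : d = e :=
  (hD x).unique ⟨hd, hdx⟩ ⟨he, hex⟩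

theorem IsED.dist_eq_three (hc : G.Connected) (hG : P6S122Free G) {D : Set V} (hD : IsED G D)
    (hv : v ∈ D) {d : V} (hd : d ∈ D) (hne : d ≠ v) : G.dist v d = 3 := by
  have h4 := hG.dist_le_four (v := v) hc d
  have h0 := mt (dist_eq_zero hc).1 hne
  have far : ∀ e ∈ D, e ≠ v → 3 ≤ G.dist v e := by
    intro e he hev
    -- At distance one the vertex is dominated by itself and by $v$; at distance two its middle
    -- neighbour is dominated by both.
    by_contra! h3
    have h2 : G.dist v e = 1 ∨ G.dist v e = 2 := by
      have := mt (dist_eq_zero hc).1 hev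
      omega
    rcases h2 with h2 | h2
    · exact hev (hD.eq he hv (Or.inl rfl) (Or.inr (SimpleGraph.dist_eq_one_iff_adj.1 h2)))
    · obtain ⟨m, me, vm, -⟩ := exists_middle hc h2
      exact hev (hD.eq he hv (Or.inr me.symm) (Or.inr vm))
  have h3 := far d hd hne
  by_contra hd3
  have hd4 : G.dist v d = 4 := by omega
  obtain ⟨x, xd, hx⟩ := exists_parent hc hd4
  obtain ⟨y, yx, hy⟩ := exists_parent hc hx
  obtain ⟨m, my, vm, hm⟩ := exists_middle hc hy
  obtain ⟨e, ⟨he, hey⟩, -⟩ := hD y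
  have hev : e ≠ v := by
    rintro rfl
    rcases hey with rfl | hey
    · simp at hy
    · exact not_adj_of_dist hc e (by simp [hy]) hey
  have he3 := far e he hev
  have ey : G.Adj e y := by
    rcases hey with rfl | hey
    · omega
    · exact hey
  have he3' := dist_le_succ_of_adj (v := v) hc ey.symm
  have hed : e ≠ d := by rintro rfl; omega
  have hv0 : G.dist v v = 0 := SimpleGraph.dist_self
  -- If $d\in N_4$, then $y\in N_2$ is the centre of an $S_{1,2,2}$ with leaf $e$ (its dominator in
  -- $N_3$) and legs $x$–$d$ and $m$–$v$.
  refine hG.not_tree ey.symm yx xd my.symm vm.symm ?_ ?_ ?_ ?_ ?_ ?_ ?_ ?_ ?_ ?_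
  · exact not_adj_of_dist hc v (by omega)
  · exact not_adj_of_dist hc v (by omega)
  · exact fun h => hed (hD.eq he hd (Or.inr h) (Or.inr xd.symm))
  · exact fun h => hed (hD.eq he hd (Or.inr h) (Or.inl rfl))
  all_goals exact not_adj_of_dist hc v (by omega)

theorem IsED.isFarED (hc : G.Connected) (hG : P6S122Free G) {D : Set V} (hD : IsED G D)
    (hv : v ∈ D) : IsFarED G v (D \ {v}) := by
  refine ⟨fun d hd => hD.dist_eq_three hc hG hv hd.1 hd.2, fun x hx => ?_⟩
  obtain ⟨d, ⟨hd, hdx⟩, huniq⟩ := hD x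
  refine ⟨d, ⟨⟨hd, ?_⟩, hdx⟩, fun e he => huniq e ⟨he.1.1, he.2⟩⟩
  rintro rfl
  have := (two_le_dist_iff hc).1 hx
  rcases hdx with rfl | h
  · exact this.1 rfl
  · exact this.2 h

theorem IsFarED.isED (hc : G.Connected) {D : Set V} (hD : IsFarED G v D) :
    IsED G (insert v D) := by
  intro x
  by_cases hx : 2 ≤ G.dist v x
  · obtain ⟨d, ⟨hd, hdx⟩, huniq⟩ := hD.2 x hx
    refine ⟨d, ⟨Or.inr hd, hdx⟩, ?_⟩
    rintro e ⟨rfl | he, hex⟩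
    · have := (two_le_dist_iff hc).1 hx
      rcases hex with rfl | h
      · exact absurd rfl this.1
      · exact absurd h this.2
    · exact huniq e ⟨he, hex⟩
  · refine ⟨v, ⟨Or.inl rfl, ?_⟩, ?_⟩
    · by_contra! h
      exact hx ((two_le_dist_iff hc).2 ⟨h.1.symm, h.2⟩)
    · rintro e ⟨rfl | he, hex⟩
      · rfl
      · have h3 := hD.1 e he
        rcases hex with rfl | h
        · omega
        · exact absurd h (not_adj_of_dist hc v (by omega))

theorem IsFarED.eq {D : Set V} (hD : IsFarED G v D) {x d e : V} (hx : 2 ≤ G.dist v x)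
    (hd : d ∈ D) (he : e ∈ D) (hdx : d = x ∨ G.Adj d x) (hex : e = x ∨ G.Adj e x) : d = e :=
  (hD.2 x hx).unique ⟨hd, hdx⟩ ⟨he, hex⟩

/-- The vertex of `D` that dominates a vertex at distance three also dominates all its
neighbours. -/
theorem IsFarED.eq_of_adj (hc : G.Connected) (hG : P6S122Free G) {D : Set V}
    (hD : IsFarED G v D) {x p d e : V} (hx : G.dist v x = 3) (xp : G.Adj x p)
    (hd : d ∈ D) (he : e ∈ D) (hdx : d = x ∨ G.Adj d x) (hep : e = p ∨ G.Adj e p) : d = e := by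
  by_contra hde
  have hd3 := hD.1 d hd
  have he3 := hD.1 e he
  have hp1 := dist_le_succ_of_adj (v := v) hc xp
  have hp2 := dist_le_succ_of_adj (v := v) hc xp.symm
  have hv0 : G.dist v v = 0 := SimpleGraph.dist_self
  have dp : ¬ G.Adj d p := fun h => hde (hD.eq (by omega) hd he (Or.inr h) hep)
  have ex : ¬ G.Adj e x := fun h => hde (hD.eq (by omega) hd he hdx (Or.inr h))
  have de : ¬ G.Adj d e := fun h => hde (hD.eq (by omega) hd he (Or.inr h) (Or.inl rfl))
  have dx : G.Adj d x := by
    rcases hdx with rfl | h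
    · exact absurd xp dp
    · exact h
  have ep : G.Adj e p := by
    rcases hep with rfl | h
    · exact absurd xp.symm ex
    · exact h
  have hp : G.dist v p = 2 ∨ G.dist v p = 3 ∨ G.dist v p = 4 := by omega
  rcases hp with hp | hp
  -- For $p\in N_2$: an $S_{1,2,2}$ centred at $p$ with leaf $e$ and legs $x$–$d$ and $m$–$v$.
  · obtain ⟨m, mp, vm, hm⟩ := exists_middle hc hp
    exact hG.not_tree ep.symm xp.symm dx.symm mp.symm vm.symm (mt G.adj_symm dp)
      (not_adj_of_dist hc v (by omega)) ex (mt G.adj_symm de) (not_adj_of_dist hc v (by omega))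
      (not_adj_of_dist hc v (by omega)) (not_adj_of_dist hc v (by omega))
      (not_adj_of_dist hc v (by omega)) (not_adj_of_dist hc v (by omega))
      (not_adj_of_dist hc v (by omega))
  -- Otherwise return to $v$ from $d$ through $y\in N_2$. If $y\sim p$, then $y$ centres an
  -- $S_{1,2,2}$ with leaf $d$ and legs $p$–$e$ and $m$–$v$. If only $y\sim x$, the path is
  -- $v\,m\,y\,x\,p\,e$; if neither, it is $v\,m\,y\,d\,x\,p$.
  · obtain ⟨y, yd, hy⟩ := exists_parent hc hd3
    obtain ⟨m, my, vm, hm⟩ := exists_middle hc hy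
    have ye : ¬ G.Adj y e := fun h =>
      hde (hD.eq (x := y) (by omega) hd he (Or.inr yd.symm) (Or.inr h.symm))
    by_cases yp : G.Adj y p
    · have hp3 := dist_le_succ_of_adj (v := v) hc yp
      exact hG.not_tree yd yp ep.symm my.symm vm.symm ye
        (not_adj_of_dist hc v (by omega)) dp de (not_adj_of_dist hc v (by omega))
        (not_adj_of_dist hc v (by omega)) (not_adj_of_dist hc v (by omega))
        (not_adj_of_dist hc v (by omega)) (not_adj_of_dist hc v (by omega))
        (not_adj_of_dist hc v (by omega))
    · by_cases yx : G.Adj y x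
      · refine hG.not_path vm my yx xp ep.symm ?_ ?_ ?_ ?_ ?_ ?_ ?_ yp ye (mt G.adj_symm ex) <;>
          exact not_adj_of_dist hc v (by omega)
      · refine hG.not_path vm my yd dx xp ?_ ?_ ?_ ?_ ?_ ?_ ?_ yx yp dp <;>
          exact not_adj_of_dist hc v (by omega)

theorem connectedComponentMk_eq_of_adj {A : Set V} {x y : A} (h : G.Adj x y) :
    (G.induce A).connectedComponentMk x = (G.induce A).connectedComponentMk y :=
  SimpleGraph.ConnectedComponent.eq.2 (SimpleGraph.Adj.reachable (by simpa using h))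

/-- Each edge of a walk inside $N_3$ keeps the dominator, by `IsFarED.eq_of_adj`. The set `A` is
left general so that it can be $N_3$ or $S\cap N_3$. -/
theorem IsFarED.eq_of_reachable (hc : G.Connected) (hG : P6S122Free G) {D : Set V}
    (hD : IsFarED G v D) {A : Set V} (hA : ∀ x ∈ A, G.dist v x = 3) {x y : A}
    (h : (G.induce A).Reachable x y) {d e : V} (hd : d ∈ D) (he : e ∈ D)
    (hdx : d = x ∨ G.Adj d x) (hey : e = y ∨ G.Adj e y) : d = e := by
  obtain ⟨p⟩ := h
  induction p generalizing d with
  | @nil a => exact hD.eq (x := a) (by rw [hA a a.2]; omega) hd he hdx hey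
  | @cons a b c hab p ih =>
    obtain ⟨f, ⟨hf, hfb⟩, -⟩ := hD.2 b (by rw [hA b b.2]; omega)
    have := hD.eq_of_adj hc hG (hA a a.2) (by simpa using hab) hd hf hdx hfb
    rw [this]
    exact ih hf hfb hey

theorem IsFarED.existsUnique_mem_component (hc : G.Connected) (hG : P6S122Free G) {D : Set V}
    (hD : IsFarED G v D) {A : Set V} (hA : ∀ x ∈ A, G.dist v x = 3) (hDA : D ⊆ A)
    (Q : (G.induce A).ConnectedComponent) : ∃! d : A, d ∈ Q.supp ∧ (d : V) ∈ D := by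
  induction Q using SimpleGraph.ConnectedComponent.ind with
  | h x =>
    obtain ⟨d, ⟨hd, hdx⟩, -⟩ := hD.2 x (by rw [hA x x.2]; omega)
    refine ⟨⟨d, hDA hd⟩, ⟨?_, hd⟩, ?_⟩
    · rw [SimpleGraph.ConnectedComponent.mem_supp_iff]
      rcases hdx with rfl | h
      · rfl
      · exact connectedComponentMk_eq_of_adj (by simpa using h)
    · rintro ⟨e, heA⟩ ⟨he, heD⟩
      rw [SimpleGraph.ConnectedComponent.mem_supp_iff, SimpleGraph.ConnectedComponent.eq] at he
      exact Subtype.ext (hD.eq_of_reachable hc hG hA he heD hd (Or.inl rfl) hdx)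

/-- A nontrivial component of the third level in a prime graph is separated by an outside vertex
that is adjacent to the vertex of `D` in the component. -/
theorem IsFarED.exists_separator (hc : G.Connected) (hG : P6S122Free G) {D S : Set V}
    (hD : IsFarED G v D) (hS : S ⊆ level G v 2 ∪ level G v 3 ∪ level G v 4) (hDS : D ⊆ S)
    (hprime : IsPrimeGraph (G.induce S))
    {Q Q' : (G.induce (S ∩ level G v 3)).ConnectedComponent} (hQ : Q.supp.Nontrivial)
    (hne : Q ≠ Q') :
    ∃ d s q : V, d ∈ D ∧ s ∈ S ∧ G.dist v q = 3 ∧ G.Adj d q ∧ G.Adj d s ∧ ¬ G.Adj s q ∧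
      (G.dist v s = 2 ∨ G.dist v s = 4) ∧ ∃ h, (G.induce (S ∩ level G v 3)).connectedComponentMk
        ⟨d, h⟩ = Q := by
  have hA : ∀ x ∈ S ∩ level G v 3, G.dist v x = 3 := fun x hx => hx.2
  have hDA : D ⊆ S ∩ level G v 3 := fun d hd => ⟨hDS hd, hD.1 d hd⟩
  obtain ⟨d, ⟨hdQ, hd⟩, -⟩ := hD.existsUnique_mem_component hc hG hA hDA Q
  have huniv : ∀ x ∈ Q.supp, (d : V) = x ∨ G.Adj d x := by
    intro x hx
    obtain ⟨e, ⟨he, hex⟩, -⟩ := hD.2 x (by rw [hA x x.2]; omega)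
    have hr : (G.induce (S ∩ level G v 3)).Reachable d x := by
      rw [← SimpleGraph.ConnectedComponent.eq]
      exact hdQ.trans hx.symm
    rwa [hD.eq_of_reachable hc hG hA hr hd he (Or.inl rfl) hex]
  -- The component viewed inside $S$. It is not homogeneous, and vertices of other components see
  -- nothing of it, so a vertex distinguishing its elements lies in $N_2\cup N_4$.
  let H : Set S := {x | ∃ h : (x : V) ∈ level G v 3, (⟨x, x.2, h⟩ : ↥(S ∩ level G v 3)) ∈ Q.supp}
  have hH : H.Nontrivial := by
    obtain ⟨a, ha, b, hb, hab⟩ := hQ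
    refine ⟨⟨a, a.2.1⟩, ⟨a.2.2, ha⟩, ⟨b, b.2.1⟩, ⟨b.2.2, hb⟩, fun h => hab ?_⟩
    exact Subtype.ext (congrArg (fun x : S => (x : V)) h)
  have hHu : H ≠ Set.univ := by
    intro h
    induction Q' using SimpleGraph.ConnectedComponent.ind with
    | h y =>
      have : (⟨y, y.2.1⟩ : S) ∈ H := h ▸ Set.mem_univ _
      obtain ⟨_, h2⟩ := this
      exact hne h2.symm
  have := hprime H
  simp only [IsHomogeneous, hH, hHu, ne_eq, not_false_eq_true, true_and, not_forall, not_or,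
    not_not] at this
  obtain ⟨s, hsH, ⟨q, ⟨hq3, hqQ⟩, hsq⟩, ⟨a, ⟨ha3, haQ⟩, hsa⟩⟩ := this
  rw [SimpleGraph.comap_adj] at hsq hsa
  simp only [Function.Embedding.subtype_apply] at hsq hsa
  have hs3 : G.dist v s ≠ 3 := by
    intro h
    refine hsH ⟨h, ?_⟩
    rw [SimpleGraph.ConnectedComponent.mem_supp_iff] at haQ ⊢
    rw [← haQ]
    exact connectedComponentMk_eq_of_adj (by simpa using hsa)
  have hs24 : G.dist v s = 2 ∨ G.dist v s = 4 := by
    rcases hS s.2 with (h | h) | h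
    · exact Or.inl h
    · exact absurd h hs3
    · exact Or.inr h
  -- The splitter has a neighbour `a` in the component, so it inherits the dominator `d` of `a`.
  obtain ⟨e, ⟨he, hes⟩, -⟩ := hD.2 s (by omega)
  have hde := hD.eq_of_adj hc hG ha3 hsa.symm hd he (huniv _ haQ) hes
  rw [← hde] at hes
  have ds : G.Adj d s := by
    rcases hes with h | h
    · have := hA d d.2
      rw [h] at this
      exact absurd this hs3
    · exact h
  refine ⟨d, s, q, hd, s.2, hq3, ?_, ds, hsq, hs24, d.2, hdQ⟩
  rcases huniv _ hqQ with h | h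
  · simp only at h
    rw [← h] at hsq
    exact absurd ds.symm hsq
  · exact h

/-- If a vertex `s'` at distance two separates the component of `d'`, then all vertices at distance
two that are dominated by another vertex of `D` are adjacent to `s'`. -/
theorem IsFarED.adj_of_separator (hc : G.Connected) (hG : P6S122Free G) {D : Set V}
    (hD : IsFarED G v D) {d d' s' q' y : V} (hd : d ∈ D) (hd' : d' ∈ D) (hne : d ≠ d')
    (hq : G.dist v q' = 3) (dq : G.Adj d' q') (hs : G.dist v s' = 2) (ds : G.Adj d' s')
    (sq : ¬ G.Adj s' q') (hy : G.dist v y = 2) (dy : G.Adj d y) : G.Adj y s' := by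
  by_contra ys
  obtain ⟨n, ns, vn, hn⟩ := exists_middle hc hs
  have hd3 := hD.1 d hd
  have hd3' := hD.1 d' hd'
  have hv0 : G.dist v v = 0 := SimpleGraph.dist_self
  have far1 : ∀ {x p : V}, G.dist v x = 3 → G.Adj x p → (d = p ∨ G.Adj d p) →
      (d' = x ∨ G.Adj d' x) → False :=
    fun h1 h2 h3 h4 => hne (hD.eq_of_adj hc hG h1 h2 hd' hd h4 h3).symm
  have d'y : ¬ G.Adj d' y := fun h => far1 hd3' h (Or.inr dy) (Or.inl rfl)
  have q'y : ¬ G.Adj q' y := fun h => far1 hq h (Or.inr dy) (Or.inr dq)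
  have d'd : ¬ G.Adj d' d := fun h => far1 hd3' h (Or.inl rfl) (Or.inl rfl)
  have q'd : ¬ G.Adj q' d := fun h => far1 hq h (Or.inl rfl) (Or.inr dq)
  have s'd : ¬ G.Adj s' d := fun h =>
    hne (hD.eq (x := s') (by omega) hd hd' (Or.inr h.symm) (Or.inr ds))
  -- Four induced paths, according to how the parents $n$ of $s'$ and $m$ of $y$ are attached:
  -- $q'd's'nyd$ if $n\sim y$, $q'd's'myd$ if $m\sim s'$, $d's'nmyd$ if $n\sim m$, and $q'd's'nvm$
  -- otherwise.
  by_cases ny : G.Adj n y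
  · exact hG.not_path dq.symm ds ns.symm ny dy.symm (mt G.adj_symm sq)
      (not_adj_of_dist hc v (by omega)) q'y q'd (not_adj_of_dist hc v (by omega)) d'y d'd
      (mt G.adj_symm ys) s'd (not_adj_of_dist hc v (by omega))
  · obtain ⟨m, my, vm, hm⟩ := exists_middle hc hy
    by_cases ms : G.Adj m s'
    · exact hG.not_path dq.symm ds ms.symm my dy.symm (mt G.adj_symm sq)
        (not_adj_of_dist hc v (by omega)) q'y q'd (not_adj_of_dist hc v (by omega)) d'y d'd
        (mt G.adj_symm ys) s'd (not_adj_of_dist hc v (by omega))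
    by_cases nm : G.Adj n m
    · exact hG.not_path ds ns.symm nm my dy.symm (not_adj_of_dist hc v (by omega))
        (not_adj_of_dist hc v (by omega)) d'y d'd (mt G.adj_symm ms) (mt G.adj_symm ys) s'd ny
        (not_adj_of_dist hc v (by omega)) (not_adj_of_dist hc v (by omega))
    · exact hG.not_path dq.symm ds ns.symm vn.symm vm (mt G.adj_symm sq)
        (not_adj_of_dist hc v (by omega)) (not_adj_of_dist hc v (by omega))
        (not_adj_of_dist hc v (by omega)) (not_adj_of_dist hc v (by omega))
        (not_adj_of_dist hc v (by omega)) (not_adj_of_dist hc v (by omega))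
        (not_adj_of_dist hc v (by omega)) (mt G.adj_symm ms) nm

/-- By `IsFarED.adj_of_separator`, $s'$ is adjacent to every $y\in N_2$ dominated by $d$. If $d$
also has a neighbour $z$ missed by $y$ and $s'$, then $q'd's'ydz$ is an induced $P_6$. For $s\in
N_2$ take $y=s$, $z=q$; for $s\in N_4$ take a parent of $d$ as $y$ and $z=s$. -/
theorem IsFarED.not_two_separators (hc : G.Connected) (hG : P6S122Free G) {D : Set V}
    (hD : IsFarED G v D) {d d' s s' q q' : V} (hd : d ∈ D) (hd' : d' ∈ D) (hne : d ≠ d')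
    (hq' : G.dist v q' = 3) (dq' : G.Adj d' q') (hs' : G.dist v s' = 2) (ds' : G.Adj d' s')
    (sq' : ¬ G.Adj s' q') (hq : G.dist v q = 3) (dq : G.Adj d q) (ds : G.Adj d s)
    (sq : ¬ G.Adj s q) (hs : G.dist v s = 2 ∨ G.dist v s = 4) : False := by
  have hd3 := hD.1 d hd
  have hd3' := hD.1 d' hd'
  have far1 : ∀ {x p : V}, G.dist v x = 3 → G.Adj x p → (d = p ∨ G.Adj d p) →
      (d' = x ∨ G.Adj d' x) → False :=
    fun h1 h2 h3 h4 => hne (hD.eq_of_adj hc hG h1 h2 hd' hd h4 h3).symm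
  have main : ∀ y z, G.dist v y = 2 → G.Adj d y → G.Adj d z → ¬ G.Adj y z → ¬ G.Adj s' z →
      False := by
    intro y z hy dy dz yz sz
    have ys := hD.adj_of_separator hc hG hd hd' hne hq' dq' hs' ds' sq' hy dy
    refine hG.not_path dq'.symm ds' ys.symm dy.symm dz (mt G.adj_symm sq') ?_ ?_ ?_ ?_ ?_ ?_ ?_ sz yz
    · exact fun h => far1 hq' h (Or.inr dy) (Or.inr dq')
    · exact fun h => far1 hq' h (Or.inl rfl) (Or.inr dq')
    · exact fun h => far1 hq' h (Or.inr dz) (Or.inr dq')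
    · exact fun h => far1 hd3' h (Or.inr dy) (Or.inl rfl)
    · exact fun h => far1 hd3' h (Or.inl rfl) (Or.inl rfl)
    · exact fun h => far1 hd3' h (Or.inr dz) (Or.inl rfl)
    · exact fun h =>
        hne (hD.eq (x := s') (by omega) hd hd' (Or.inr h.symm) (Or.inr ds'))
  rcases hs with hs | hs
  · refine main s q hs ds dq sq fun h => hne ?_
    exact hD.eq_of_adj hc hG hq h.symm hd hd' (Or.inr dq) (Or.inr ds')
  · obtain ⟨y, yd, hy⟩ := exists_parent hc hd3
    exact main y s hy yd.symm ds (not_adj_of_dist hc v (by omega))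
      (not_adj_of_dist hc v (by omega))

theorem IsFarED.eq_of_nontrivial (hc : G.Connected) (hG : P6S122Free G) {D S : Set V}
    (hD : IsFarED G v D) (hS : S ⊆ level G v 2 ∪ level G v 3 ∪ level G v 4) (hDS : D ⊆ S)
    (hprime : IsPrimeGraph (G.induce S))
    (hjoin : ∀ x ∈ S ∩ level G v 3, (∀ z ∈ S ∩ level G v 4, G.Adj x z) ∨
      (∀ z ∈ S ∩ level G v 4, ¬ G.Adj x z))
    (Q Q' : (G.induce (S ∩ level G v 3)).ConnectedComponent) (hQ : Q.supp.Nontrivial)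
    (hQ' : Q'.supp.Nontrivial) : Q = Q' := by
  by_contra hne
  obtain ⟨d, s, q, hd, hsS, hq, dq, ds, sq, hs, hdA, hdQ⟩ :=
    hD.exists_separator hc hG hS hDS hprime hQ hne
  obtain ⟨d', s', q', hd', hsS', hq', dq', ds', sq', hs', hdA', hdQ'⟩ :=
    hD.exists_separator hc hG hS hDS hprime hQ' (Ne.symm hne)
  have hdd : d ≠ d' := by
    rintro rfl
    exact hne (hdQ.symm.trans hdQ')
  rcases hs' with h2' | h4'
  · exact hD.not_two_separators hc hG hd hd' hdd hq' dq' h2' ds' sq' hq dq ds sq hs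
  rcases hs with h2 | h4
  · exact hD.not_two_separators hc hG hd' hd hdd.symm hq dq h2 ds sq hq' dq' ds' sq' (Or.inr h4')
  · have hd3 := hD.1 d hd
    -- With both splitters in $N_4$, the centre `d` sees `s`, hence all of $S\cap N_4$, including
    -- `s'`, which then has two dominators.
    rcases hjoin d ⟨hDS hd, hd3⟩ with h | h
    · exact hdd (hD.eq (x := s') (by omega) hd hd' (Or.inr (h s' ⟨hsS', h4'⟩)) (Or.inr ds'))
    · exact h s ⟨hsS, h4⟩ ds

end Structure

/-! ### Locally optimal vertices form an optimal solution -/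

section Selection

variable {n : ℕ} {G : SimpleGraph (Fin n)} {v : Fin n} {w : Fin n → ℕ∞} {deg : Fin n → ℕ}

/-- The selection key: large degree first, then small weight, then small number. -/
def selKey (deg : Fin n → ℕ) (w : Fin n → ℕ∞) (x : Fin n) : ℕᵒᵈ ×ₗ ℕ∞ ×ₗ Fin n :=
  toLex (OrderDual.toDual (deg x), toLex (w x, x))

theorem selKey_lt_iff {x y : Fin n} : selKey deg w x < selKey deg w y ↔
    deg y < deg x ∨ deg x = deg y ∧ (w x < w y ∨ w x = w y ∧ x < y) := by
  simp [selKey, Prod.Lex.toLex_lt_toLex]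

theorem selKey_injective : Function.Injective (selKey deg w) := by
  intro x y h
  simp only [selKey, EmbeddingLike.apply_eq_iff_eq, Prod.mk.injEq] at h
  exact h.2.2

/-- The vertices at distance three from `v` of finite weight. -/
def candidates (G : SimpleGraph (Fin n)) (w : Fin n → ℕ∞) (v : Fin n) : Set (Fin n) :=
  {x | G.dist v x = 3 ∧ w x ≠ ⊤}

/-- The candidates without a better candidate among their neighbours. -/
def selection (G : SimpleGraph (Fin n)) (w : Fin n → ℕ∞) (deg : Fin n → ℕ) (v : Fin n) :
    Set (Fin n) :=
  {x | x ∈ candidates G w v ∧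
    ∀ y, G.Adj x y → y ∈ candidates G w v → ¬ selKey deg w y < selKey deg w x}

def closedNbhd (G : SimpleGraph (Fin n)) (x : Fin n) : Set (Fin n) := {y | y = x ∨ G.Adj x y}

theorem mem_closedNbhd {d x : Fin n} : x ∈ closedNbhd G d ↔ d = x ∨ G.Adj d x := by
  simp only [closedNbhd, Set.mem_ofPred_eq, eq_comm]

theorem IsFarED.eq_of_mem_closedNbhd (hc : G.Connected) (hG : P6S122Free G) {D : Set (Fin n)}
    (hD : IsFarED G v D) {x p d e : Fin n} (hx : G.dist v x = 3) (xp : p ∈ closedNbhd G x)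
    (hd : d ∈ D) (he : e ∈ D) (hdx : x ∈ closedNbhd G d) (hep : p ∈ closedNbhd G e) : d = e := by
  rcases xp with rfl | xp
  · exact hD.eq (x := p) (by omega) hd he (mem_closedNbhd.1 hdx) (mem_closedNbhd.1 hep)
  · exact hD.eq_of_adj hc hG hx xp hd he (mem_closedNbhd.1 hdx) (mem_closedNbhd.1 hep)

theorem two_le_dist_of_mem_closedNbhd (hc : G.Connected) {x p : Fin n} (hx : G.dist v x = 3)
    (hp : p ∈ closedNbhd G x) : 2 ≤ G.dist v p := by
  rcases hp with rfl | hp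
  · omega
  · have := dist_le_succ_of_adj (v := v) hc hp.symm
    omega

theorem IsFarED.closedNbhd_subset (hc : G.Connected) (hG : P6S122Free G) {D : Set (Fin n)}
    (hD : IsFarED G v D) {x d : Fin n} (hd : d ∈ D) (hx : G.dist v x = 3)
    (hdx : x ∈ closedNbhd G d) : closedNbhd G x ⊆ closedNbhd G d := by
  intro p hp
  obtain ⟨e, ⟨he, hep⟩, -⟩ := hD.2 p (two_le_dist_of_mem_closedNbhd hc hx hp)
  rw [← mem_closedNbhd] at hep
  rwa [hD.eq_of_mem_closedNbhd hc hG hx hp hd he hdx hep]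

/-- Under inclusion of closed neighbourhoods, true twins are recognised by degree alone, which the
machine can read off the offsets. -/
theorem ncard_closedNbhd (hdeg : ∀ x, deg x + 1 = (closedNbhd G x).ncard) {x y : Fin n}
    (h : closedNbhd G x ⊆ closedNbhd G y) :
    deg x ≤ deg y ∧ (deg x = deg y ↔ closedNbhd G x = closedNbhd G y) := by
  have h1 := Set.ncard_le_ncard h
  rw [← hdeg, ← hdeg] at h1
  refine ⟨by omega, fun h2 => ?_, fun h2 => ?_⟩
  · exact Set.eq_of_subset_of_ncard_le h (by rw [← hdeg, ← hdeg, h2])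
  · have := hdeg x
    rw [h2, ← hdeg y] at this
    omega

/-- A selected vertex has the same neighbourhood as the vertex of `D` dominating it. -/
theorem IsFarED.closedNbhd_eq (hc : G.Connected) (hG : P6S122Free G)
    (hdeg : ∀ x, deg x + 1 = (closedNbhd G x).ncard) {D : Set (Fin n)}
    (hD : IsFarED G v D) (hw : ∀ d ∈ D, w d ≠ ⊤) {c d : Fin n} (hd : d ∈ D)
    (hcs : c ∈ selection G w deg v) (hcd : c ∈ closedNbhd G d) :
    closedNbhd G c = closedNbhd G d ∧ w c ≤ w d := by
  have hsub := hD.closedNbhd_subset hc hG hd hcs.1.1 hcd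
  have hcard := ncard_closedNbhd hdeg hsub
  rcases hcd with rfl | hcd
  · exact ⟨rfl, le_rfl⟩
  -- `d` is itself a candidate adjacent to `c` and does not beat it, so its degree is no larger; the
  -- inclusion gives the other inequality.
  · have := hcs.2 d hcd.symm ⟨hD.1 d hd, hw d hd⟩
    rw [selKey_lt_iff] at this
    push Not at this
    have heq : deg c = deg d := le_antisymm hcard.1 this.1
    exact ⟨hcard.2.1 heq, (this.2 heq.symm).1⟩

/-- The twin `c` of `d` with the best key is unbeaten: a candidate neighbour lies in $N[d]$, so it
is either another twin or of smaller degree. Any other selected vertex of $N[d]$ would be a twin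
adjacent to `c`, and since keys are distinct one of the two would beat the other. -/
theorem IsFarED.exists_selected (hc : G.Connected) (hG : P6S122Free G)
    (hdeg : ∀ x, deg x + 1 = (closedNbhd G x).ncard) {D : Set (Fin n)}
    (hD : IsFarED G v D) (hw : ∀ d ∈ D, w d ≠ ⊤) {d : Fin n} (hd : d ∈ D) :
    ∃ c ∈ selection G w deg v, closedNbhd G c = closedNbhd G d ∧
      ∀ c' ∈ selection G w deg v, c' ∈ closedNbhd G d → c' = c := by
  classical
  let C : Finset (Fin n) :=
    Finset.univ.filter fun c => c ∈ candidates G w v ∧ closedNbhd G c = closedNbhd G d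
  obtain ⟨c, hcC, hmin⟩ := C.exists_min_image (selKey deg w)
    ⟨d, Finset.mem_filter.2 ⟨Finset.mem_univ d, ⟨hD.1 d hd, hw d hd⟩, rfl⟩⟩
  simp only [C, Finset.mem_filter, Finset.mem_univ, true_and] at hcC hmin
  have hmem : c ∈ selection G w deg v := by
    refine ⟨hcC.1, fun y hy hyc hlt => ?_⟩
    have hyd : y ∈ closedNbhd G d := hcC.2 ▸ Or.inr hy
    have hcard := ncard_closedNbhd hdeg (hD.closedNbhd_subset hc hG hd hyc.1 hyd)
    have hcard' := ncard_closedNbhd hdeg hcC.2.le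
    by_cases heq : closedNbhd G y = closedNbhd G d
    · exact absurd hlt (not_lt.2 (hmin y ⟨hyc, heq⟩))
    · rw [← hcard.2] at heq
      rw [selKey_lt_iff] at hlt
      have := hcard'.2.2 hcC.2
      omega
  refine ⟨c, hmem, hcC.2, fun c' hc' hcd' => ?_⟩
  have h1 := (hD.closedNbhd_eq hc hG hdeg hw hd hc' hcd').1
  have h2 : c' ∈ closedNbhd G c := by rwa [hcC.2]
  rcases h2 with h2 | h2
  · exact h2
  · have h3 := hc'.2 c h2.symm hmem.1
    exact selKey_injective (le_antisymm (not_lt.1 h3) (hmin c' ⟨hc'.1, h1⟩))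

/-- Replacing each $d$ by its selected twin leaves the dominated sets unchanged. No selected vertex
is left over: each is dominated by some element of $D$, and anything it dominates has that same
dominator. -/
theorem IsFarED.isFarED_selection (hc : G.Connected) (hG : P6S122Free G)
    (hdeg : ∀ x, deg x + 1 = (closedNbhd G x).ncard) {D : Set (Fin n)}
    (hD : IsFarED G v D) (hw : ∀ d ∈ D, w d ≠ ⊤) : IsFarED G v (selection G w deg v) := by
  refine ⟨fun d hd => hd.1.1, fun x hx => ?_⟩
  obtain ⟨d, ⟨hd, hdx⟩, -⟩ := hD.2 x hx
  rw [← mem_closedNbhd] at hdx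
  obtain ⟨c, hcs, hcd, huniq⟩ := hD.exists_selected hc hG hdeg hw hd
  refine ⟨c, ⟨hcs, mem_closedNbhd.1 (hcd ▸ hdx)⟩, fun c' ⟨hc', hcx'⟩ => huniq c' hc' ?_⟩
  rw [← mem_closedNbhd] at hcx'
  obtain ⟨e, ⟨he, hec⟩, -⟩ := hD.2 c' (by rw [hc'.1.1]; omega)
  rw [← mem_closedNbhd] at hec
  rwa [← hD.eq_of_mem_closedNbhd hc hG hc'.1.1 hcx' he hd hec hdx]

theorem IsFarED.weight_selection_le (hc : G.Connected) (hG : P6S122Free G)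
    (hdeg : ∀ x, deg x + 1 = (closedNbhd G x).ncard) {D S : Finset (Fin n)}
    (hD : IsFarED G v D) (hw : ∀ d ∈ D, w d ≠ ⊤)
    (hS : (S : Set (Fin n)) = selection G w deg v) : weight w S ≤ weight w D := by
  classical
  have hsel : ∀ c, c ∈ S ↔ c ∈ selection G w deg v := fun c => by rw [← hS, Finset.mem_coe]
  have hex : ∀ c, ∃ d, c ∈ S → d ∈ D ∧ c ∈ closedNbhd G d := by
    intro c
    by_cases h : c ∈ S
    · obtain ⟨d, ⟨hd, hdc⟩, -⟩ := hD.2 c (by rw [((hsel c).1 h).1.1]; omega)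
      exact ⟨d, fun _ => ⟨hd, mem_closedNbhd.2 hdc⟩⟩
    · exact ⟨c, fun h' => absurd h' h⟩
  -- `f` sends a selected vertex to its dominator in `D`. It is injective on the selection, because
  -- each $N[d]$ contains only one selected vertex, and it does not decrease weights.
  choose f hf using hex
  calc weight w S ≤ ∑ c ∈ S, w (f c) := Finset.sum_le_sum fun c hcS =>
        (hD.closedNbhd_eq hc hG hdeg hw (hf c hcS).1 ((hsel c).1 hcS) (hf c hcS).2).2
    _ = ∑ d ∈ S.image f, w d := by
        rw [Finset.sum_image]
        intro c hcS c' hcS' heq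
        obtain ⟨c₀, -, -, huniq⟩ := hD.exists_selected hc hG hdeg hw (hf c hcS).1
        rw [huniq c ((hsel c).1 hcS) (hf c hcS).2,
          huniq c' ((hsel c').1 hcS') (heq ▸ (hf c' hcS').2)]
    _ ≤ weight w D := by
        refine Finset.sum_le_sum_of_subset fun d hd => ?_
        obtain ⟨c, hcS, rfl⟩ := Finset.mem_image.1 hd
        exact (hf c hcS).1

end Selection

/-! ### Time-bounded Hoare rules for programs -/

section Runs

/-- Started in `s`, the program halts within `T` time units in a state that satisfies `Q`. -/
def Runs (p : Prog) (s : State) (T : ℕ) (Q : State → Prop) : Prop :=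
  ∃ s' t, Exec p s s' t ∧ t ≤ T ∧ Q s'

theorem Runs.mono {p : Prog} {s : State} {T T' : ℕ} {Q Q' : State → Prop} (h : Runs p s T Q)
    (hT : T ≤ T') (hQ : ∀ s', Q s' → Q' s') : Runs p s T' Q' := by
  obtain ⟨s', t, he, ht, hq⟩ := h
  exact ⟨s', t, he, ht.trans hT, hQ _ hq⟩

theorem Runs.seq {p q : Prog} {s : State} {T U : ℕ} {Q R : State → Prop} (h : Runs p s T Q)
    (h' : ∀ s', Q s' → Runs q s' U R) : Runs (.seq p q) s (T + U) R := by
  obtain ⟨s₁, t, he, ht, hq⟩ := h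
  obtain ⟨s₂, u, he', hu, hr⟩ := h' _ hq
  exact ⟨s₂, t + u, .seq he he', by omega, hr⟩

theorem Runs.skip {s : State} {Q : State → Prop} (h : Q s) : Runs .skip s 1 Q :=
  ⟨_, _, .skip s, le_rfl, h⟩

theorem Runs.assign {x : ℕ} {e : Expr} {s : State} {Q : State → Prop}
    (h : Q (s.setVar x (e.eval s))) : Runs (.assign x e) s (e.cost + 1) Q :=
  ⟨_, _, .assign s x e, le_rfl, h⟩

theorem Runs.assign_seq {x k : ℕ} {e : Expr} {q : Prog} {s : State} {U : ℕ} {R : State → Prop}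
    (hk : e.eval s = k) (h : Runs q (s.setVar x k) U R) :
    Runs (.seq (.assign x e) q) s (e.cost + 1 + U) R :=
  .seq (.assign (Q := fun t => t = s.setVar x k) (by rw [hk])) fun _ ht => ht ▸ h

theorem Runs.write {a : ℕ} {i e : Expr} {s : State} {Q : State → Prop}
    (h : Q (s.setArr a (i.eval s) (e.eval s))) : Runs (.write a i e) s (i.cost + e.cost + 1) Q :=
  ⟨_, _, .write s a i e, le_rfl, h⟩

theorem Runs.ite {e : Expr} {p q : Prog} {s : State} {T : ℕ} {Q : State → Prop}
    (hp : e.eval s ≠ 0 → Runs p s T Q) (hq : e.eval s = 0 → Runs q s T Q) :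
    Runs (.ite e p q) s (e.cost + 1 + T) Q := by
  by_cases h : e.eval s = 0
  · obtain ⟨s', t, he, ht, hr⟩ := hq h
    exact ⟨s', _, .iteFalse h he, by omega, hr⟩
  · obtain ⟨s', t, he, ht, hr⟩ := hp h
    exact ⟨s', _, .iteTrue h he, by omega, hr⟩

/-- The rule for loops in which variable `i` counts up to the value `b` of variable `h`. -/
theorem Runs.loop {i h : ℕ} {p : Prog} (Inv : ℕ → State → Prop) (c : ℕ → ℕ) {b : ℕ}
    (hvar : ∀ k s, Inv k s → s.var i = k ∧ s.var h = b) {a : ℕ} (hab : a ≤ b)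
    (hbody : ∀ k s, a ≤ k → k < b → Inv k s → Runs p s (c k) (Inv (k + 1)))
    {s : State} (hs : Inv a s) :
    -- Each test costs three expression nodes plus one unit; the final 4 pays for the failing test.
    Runs (.while (.sub (.var h) (.var i)) p) s (∑ k ∈ Finset.Ico a b, (c k + 4) + 4) (Inv b) := by
  induction hab using Nat.decreasingInduction generalizing s with
  | self =>
    refine ⟨s, _, .whileFalse ?_, ?_, hs⟩
    · obtain ⟨h1, h2⟩ := hvar b s hs
      simp [Expr.eval, h1, h2]
    · simp [Expr.cost]
  | of_succ k hk ih =>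
    obtain ⟨h1, h2⟩ := hvar k s hs
    obtain ⟨s₁, t, he, ht, hq⟩ := hbody k s le_rfl hk hs
    obtain ⟨s₂, u, he', hu, hr⟩ := ih (fun j s hj => hbody j s (by omega)) hq
    refine ⟨s₂, _, .whileTrue ?_ he he', ?_, hr⟩
    · simp only [Expr.eval, h1, h2]
      omega
    · rw [Finset.sum_eq_sum_Ico_succ_bot hk]
      simp only [Expr.cost]
      omega

@[simp] theorem State.setVar_var (s : State) (x k y : ℕ) :
    (s.setVar x k).var y = if y = x then k else s.var y := by
  simp [State.setVar, Function.update_apply]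

@[simp] theorem State.setVar_arr (s : State) (x k : ℕ) : (s.setVar x k).arr = s.arr := rfl

@[simp] theorem State.setArr_var (s : State) (a i k : ℕ) : (s.setArr a i k).var = s.var := rfl

theorem State.setArr_arr_same (s : State) (a i k j : ℕ) :
    (s.setArr a i k).arr a j = if j = i then k else s.arr a j := by
  simp [State.setArr, Function.update_apply]

theorem State.setArr_arr_ne (s : State) {a b : ℕ} (i k : ℕ) (h : b ≠ a) :
    (s.setArr a i k).arr b = s.arr b := by
  simp [State.setArr, h]

end Runs

/-! ### The graph as stored in memory -/

section AdjacencyLists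

variable {n : ℕ} {G : SimpleGraph (Fin n)}

theorem AdjLists.offset_zero (L : AdjLists G) : L.offset 0 = 0 := by
  simp [AdjLists.offset]

theorem AdjLists.offset_succ (L : AdjLists G) (x : Fin n) :
    L.offset (x + 1) = L.offset x + (L.nbrs x).length := by
  have : (Finset.univ.filter fun u : Fin n => u.val < x + 1) =
      insert x (Finset.univ.filter fun u : Fin n => u.val < x) := by
    ext u
    simp only [Finset.mem_filter, Finset.mem_univ, true_and, Finset.mem_insert, Fin.ext_iff]
    omega
  rw [AdjLists.offset, this, Finset.sum_insert (by simp), add_comm]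
  rfl

theorem AdjLists.length_eq_degree [DecidableRel G.Adj] (L : AdjLists G) (x : Fin n) :
    (L.nbrs x).length = G.degree x := by
  rw [← List.toFinset_card_of_nodup (L.nodup x), ← G.card_neighborFinset_eq_degree]
  congr 1
  ext y
  simp [L.mem_iff]

theorem AdjLists.offset_last [DecidableRel G.Adj] (L : AdjLists G) :
    L.offset n = 2 * G.edgeFinset.card := by
  rw [← G.sum_degrees_eq_twice_card_edges, AdjLists.offset]
  simp [L.length_eq_degree]

theorem AdjLists.length_flatMap_take (L : AdjLists G) {i : ℕ} (hi : i ≤ n) :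
    (((List.finRange n).take i).flatMap fun u => (L.nbrs u).map Fin.val).length = L.offset i := by
  induction i with
  | zero => simp [L.offset_zero]
  | succ i ih =>
    have h := L.offset_succ ⟨i, hi⟩
    simp only at h
    rw [h, ← ih (by omega), List.take_succ_eq_append_getElem (by simpa using hi),
      List.flatMap_append, List.length_append]
    simp

theorem AdjLists.concat_getD (L : AdjLists G) (x : Fin n) {k : ℕ} (hk : k < (L.nbrs x).length) :
    L.concat.getD (L.offset x + k) 0 = ((L.nbrs x)[k] : ℕ) := by
  have h : L.concat = (((List.finRange n).take x).flatMap fun u => (L.nbrs u).map Fin.val) ++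
      ((L.nbrs x).map Fin.val ++
        ((List.finRange n).drop (x + 1)).flatMap fun u => (L.nbrs u).map Fin.val) := by
    have e : List.finRange n =
        (List.finRange n).take x ++ x :: (List.finRange n).drop (x + 1) := by
      conv_lhs => rw [← List.take_append_drop x (List.finRange n)]
      rw [List.drop_eq_getElem_cons (by simp)]
      simp
    rw [AdjLists.concat]
    conv_lhs => rw [e]
    rw [List.flatMap_append, List.flatMap_cons]
  rw [h, List.getD_append_right _ _ _ _ (by rw [L.length_flatMap_take x.2.le]; omega),
    L.length_flatMap_take x.2.le, Nat.add_sub_cancel_left,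
    List.getD_append _ _ _ _ (by simpa using hk), List.getD_eq_getElem _ _ (by simpa using hk)]
  simp

/-- The memory contains the graph and the weights. -/
structure Loaded (L : AdjLists G) (w : Fin n → ℕ∞) (s : State) : Prop where
  size : s.var 0 = n
  weights : ∀ x : Fin n, s.arr 0 x = encodeWeight (w x)
  offsets : ∀ i ≤ n, s.arr 1 i = L.offset i
  lists : ∀ (x : Fin n) (k : ℕ) (hk : k < (L.nbrs x).length),
    s.arr 2 (L.offset x + k) = ((L.nbrs x)[k] : ℕ)

theorem loaded_input (L : AdjLists G) (w : Fin n → ℕ∞) (v : ℕ) : Loaded L w (input L w v) where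
  size := by simp [input]
  weights x := by simp [input]
  offsets i hi := by simp [input, hi]
  lists x k hk := by
    rw [← L.concat_getD x hk]
    simp [input]

theorem Loaded.of_eq {L : AdjLists G} {w : Fin n → ℕ∞} {s s' : State} (h : Loaded L w s)
    (hv : s'.var 0 = s.var 0) (h0 : s'.arr 0 = s.arr 0) (h1 : s'.arr 1 = s.arr 1)
    (h2 : s'.arr 2 = s.arr 2) : Loaded L w s' where
  size := hv ▸ h.size
  weights := h0 ▸ h.weights
  offsets := h1 ▸ h.offsets
  lists := h2 ▸ h.lists

end AdjacencyLists

/-! ### One sweep over all adjacency lists -/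

section Pass

/-- The states agree except for the variables `3, …, 7` and the array `out`. -/
def SameOff (out : ℕ) (s s' : State) : Prop :=
  (∀ z, z ∉ ({3, 4, 5, 6, 7} : Finset ℕ) → s'.var z = s.var z) ∧ ∀ a, a ≠ out → s'.arr a = s.arr a

theorem SameOff.refl (out : ℕ) (s : State) : SameOff out s s := ⟨fun _ _ => rfl, fun _ _ => rfl⟩

theorem SameOff.setVar {out : ℕ} {s s' : State} (h : SameOff out s s') {x : ℕ} (k : ℕ)
    (hx : x ∈ ({3, 4, 5, 6, 7} : Finset ℕ)) : SameOff out s (s'.setVar x k) := by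
  refine ⟨fun z hz => ?_, h.2⟩
  rw [State.setVar_var, if_neg (by rintro rfl; exact hz hx), h.1 z hz]

theorem SameOff.setArr {out : ℕ} {s s' : State} (h : SameOff out s s') (i k : ℕ) :
    SameOff out s (s'.setArr out i k) :=
  ⟨h.1, fun a ha => by rw [State.setArr_arr_ne _ _ _ ha, h.2 a ha]⟩

/-- For every neighbour, number `var 6`, of the vertex `var 3`, add the value of `f` to
`var 7`. -/
def gather (f : Expr) : Prog :=
  .while (.sub (.var 5) (.var 4))
    (.seq (.assign 6 (.read 2 (.var 4)))
      (.seq (.assign 7 (.add (.var 7) f)) (.assign 4 (.add (.var 4) (.const 1)))))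

/-- For every vertex `x`, set `out[x]` to the value of `g`, evaluated with `x` in `var 3` and, in
`var 7`, the sum of the values of `f` over the neighbours of `x`. -/
def pass (out : ℕ) (f g : Expr) : Prog :=
  .seq (.assign 3 (.const 0)) (.while (.sub (.var 0) (.var 3))
    (.seq (.assign 7 (.const 0))
      (.seq (.assign 4 (.read 1 (.var 3)))
        (.seq (.assign 5 (.read 1 (.add (.var 3) (.const 1))))
          (.seq (gather f)
            (.seq (.write out (.var 3) g) (.assign 3 (.add (.var 3) (.const 1)))))))))

variable {n : ℕ} {G : SimpleGraph (Fin n)} {L : AdjLists G} {w : Fin n → ℕ∞}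

/-- The hypothesis on `f` ranges over all states that agree with `s` off the scratch variables and
`out`, so a half-written output array cannot influence the sum. -/
theorem runs_gather {out : ℕ} {f : Expr} {s s₁ : State} (hL : Loaded L w s) (hout : 3 ≤ out)
    (hs : SameOff out s s₁) {x : Fin n} {F : Fin n → ℕ}
    (hf : ∀ (y : Fin n) s', SameOff out s s' → s'.var 3 = x → s'.var 6 = y → f.eval s' = F y)
    (h3 : s₁.var 3 = x) (h4 : s₁.var 4 = L.offset x) (h5 : s₁.var 5 = L.offset (x + 1))
    (h7 : s₁.var 7 = 0) :
    Runs (gather f) s₁ ((L.nbrs x).length * (f.cost + 14) + 4) fun s' =>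
      SameOff out s s' ∧ s'.var 3 = x ∧ s'.var 7 = ((L.nbrs x).map F).sum ∧
        s'.arr out = s₁.arr out := by
  have hoff := L.offset_succ x
  have := Runs.loop (i := 4) (h := 5) (b := L.offset (x + 1))
    (p := .seq (.assign 6 (.read 2 (.var 4)))
      (.seq (.assign 7 (.add (.var 7) f)) (.assign 4 (.add (.var 4) (.const 1)))))
    (fun k s' => (s'.var 4 = k ∧ s'.var 5 = L.offset (x + 1)) ∧ SameOff out s s' ∧ s'.var 3 = x ∧
      s'.var 7 = (((L.nbrs x).take (k - L.offset x)).map F).sum ∧ s'.arr out = s₁.arr out)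
    (fun _ => f.cost + 10) (fun k s' h => h.1) (a := L.offset x) (by omega) ?_
    (s := s₁) ⟨⟨h4, h5⟩, hs, h3, by simp [h7], rfl⟩
  · refine this.mono ?_ ?_
    · rw [Finset.sum_const, Nat.card_Ico, hoff, Nat.add_sub_cancel_left, smul_eq_mul]
    · rintro s' ⟨-, h1, h2, h3, h4⟩
      refine ⟨h1, h2, ?_, h4⟩
      rw [h3, List.take_of_length_le (by omega)]
  · rintro k s' hk hk' ⟨⟨h4, h5⟩, hs', h3, h7, ho⟩
    obtain ⟨j, rfl⟩ := Nat.exists_eq_add_of_le hk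
    have hj : j < (L.nbrs x).length := by omega
    have hread : s'.arr 2 (L.offset x + j) = ((L.nbrs x)[j] : ℕ) := by
      rw [hs'.2 2 (by omega), hL.lists x j hj]
    have hs6 := hs'.setVar ((L.nbrs x)[j] : ℕ) (x := 6) (by decide)
    have hfe := hf (L.nbrs x)[j] _ hs6 (by simp [h3]) (by simp)
    refine Runs.mono (.seq (.assign (Q := fun s => s = s'.setVar 6 ((L.nbrs x)[j] : ℕ)) ?_)
      fun s₂ h₂ => .seq (.assign (Q := fun s => s = s₂.setVar 7 (s₂.var 7 + F (L.nbrs x)[j])) ?_)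
      fun s₃ h₃ => .assign ?_) ?_ (fun _ h => h)
    · simp only [Expr.eval, h4, hread]
    · subst h₂
      simp only [Expr.eval, hfe]
    · subst h₃ h₂
      refine ⟨by simp [Expr.eval, h4, h5, add_assoc], ?_, by simp [h3], ?_, by simpa using ho⟩
      · exact ((hs6.setVar _ (by decide)).setVar _ (by decide))
      · rw [show L.offset x + j + 1 - L.offset x = j + 1 by omega,
          List.take_succ_eq_append_getElem hj,
          List.map_append, List.sum_append]
        simp [h7]
    · simp only [Expr.cost]
      omega

theorem runs_pass [DecidableRel G.Adj] {out : ℕ} {f g : Expr} {s : State} (hL : Loaded L w s)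
    (hout : 3 ≤ out) (F : Fin n → Fin n → ℕ) (H : Fin n → ℕ)
    (hf : ∀ (x y : Fin n) s', SameOff out s s' → s'.var 3 = x → s'.var 6 = y → f.eval s' = F x y)
    (hg : ∀ (x : Fin n) s', SameOff out s s' → s'.var 3 = x →
      s'.var 7 = ((L.nbrs x).map (F x)).sum → g.eval s' = H x) :
    Runs (pass out f g) s ((f.cost + g.cost + 30) * (n + 2 * G.edgeFinset.card + 1)) fun s' =>
      SameOff out s s' ∧ ∀ x : Fin n, s'.arr out x = H x := by
  have := Runs.loop (i := 3) (h := 0) (b := n)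
    (p := (.seq (.assign 7 (.const 0))
      (.seq (.assign 4 (.read 1 (.var 3)))
        (.seq (.assign 5 (.read 1 (.add (.var 3) (.const 1))))
          (.seq (gather f)
            (.seq (.write out (.var 3) g) (.assign 3 (.add (.var 3) (.const 1)))))))))
    (fun k s' => (s'.var 3 = k ∧ s'.var 0 = n) ∧ SameOff out s s' ∧
      ∀ x : Fin n, x < k → s'.arr out x = H x)
    -- The cost of vertex `k` is proportional to its list length plus a constant; the list lengths
    -- telescope to $2m$, which makes the sweep linear.
    (fun k => (L.offset (k + 1) - L.offset k) * (f.cost + 14) + g.cost + 20)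
    (fun k s' h => h.1) (a := 0) (Nat.zero_le n) ?_
    (s := s.setVar 3 0) ⟨⟨by simp, by simp [hL.size]⟩, (SameOff.refl out s).setVar 0 (by decide),
      fun x hx => absurd hx (Nat.not_lt_zero _)⟩
  · refine Runs.mono (.seq (.assign (Q := fun s' => s' = s.setVar 3 0) rfl)
      fun s' hs' => hs' ▸ this) ?_ fun s' h => ⟨h.2.1, fun x => h.2.2 x x.2⟩
    have hmono : Monotone L.offset := fun i j hij =>
      Finset.sum_le_sum_of_subset fun u hu => by
        simp only [Finset.mem_filter, Finset.mem_univ, true_and] at hu ⊢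
        omega
    rw [← L.offset_last, ← Finset.range_eq_Ico]
    have htel := Finset.sum_range_tsub hmono n
    rw [L.offset_zero, Nat.sub_zero] at htel
    simp only [Finset.sum_add_distrib, ← Finset.sum_mul, htel, Finset.sum_const, Finset.card_range,
      smul_eq_mul, Expr.cost]
    nlinarith [Nat.zero_le (L.offset n * g.cost), Nat.zero_le (n * f.cost)]
  · rintro k s' - hk ⟨⟨h3, h0⟩, hs, ho⟩
    have hoff := L.offset_succ ⟨k, hk⟩
    have ha1 : s'.arr 1 = s.arr 1 := hs.2 1 (by omega)
    simp only at hoff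
    have hs₁ := ((hs.setVar 0 (x := 7) (by decide)).setVar (L.offset k) (x := 4)
      (by decide)).setVar (L.offset (k + 1)) (x := 5) (by decide)
    refine Runs.mono (.seq (.assign (Q := fun t => t = s'.setVar 7 0) rfl) fun s₂ h₂ =>
      .seq (.assign (Q := fun t => t = (s'.setVar 7 0).setVar 4 (L.offset k)) ?_) fun s₃ h₃ =>
      .seq (.assign (Q := fun t => t = ((s'.setVar 7 0).setVar 4 (L.offset k)).setVar 5
        (L.offset (k + 1))) ?_) fun s₄ h₄ =>
      .seq (h₄ ▸ runs_gather (x := ⟨k, hk⟩) hL hout hs₁ (hf ⟨k, hk⟩) (by simp [h3]) (by simp)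
        (by simp) (by simp)) fun s₅ h₅ =>
      .seq (.write (Q := fun t => t = s₅.setArr out k (H ⟨k, hk⟩)) ?_)
        fun s₆ h₆ => .assign ?_) ?_ (fun _ h => h)
    · subst h₂
      simp [Expr.eval, h3, ha1, hL.offsets k hk.le]
    · subst h₃
      simp [Expr.eval, h3, ha1, hL.offsets (k + 1) hk]
    · rw [hg ⟨k, hk⟩ s₅ h₅.1 h₅.2.1 h₅.2.2.1]
      simp [Expr.eval, h₅.2.1]
    · subst h₆
      obtain ⟨hs₅, h53, -, h5o⟩ := h₅
      refine ⟨⟨by simp [Expr.eval, h53], ?_⟩, (hs₅.setArr _ _).setVar _ (by decide), ?_⟩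
      · simp [hs₅.1 0 (by decide), hL.size]
      · intro x hx
        rw [State.setVar_arr, State.setArr_arr_same]
        split_ifs with h
        · congr 1
          exact Fin.ext h.symm
        · rw [h5o, h₄]
          exact ho x (by omega)
    · simp only [Expr.cost, hoff, Nat.add_sub_cancel_left]
      omega

end Pass

/-! ### Logic by truncated subtraction -/

section Indicator

open Classical in
/-- The number `1` or `0` according to whether `P` holds. -/
noncomputable def ind (P : Prop) : ℕ := if P then 1 else 0

theorem ind_ne_zero {P : Prop} : ind P ≠ 0 ↔ P := by
  by_cases h : P <;> simp [ind, h]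

theorem ind_eq_zero {P : Prop} : ind P = 0 ↔ ¬ P := by
  by_cases h : P <;> simp [ind, h]

theorem ind_congr {P Q : Prop} (h : P ↔ Q) : ind P = ind Q := by rw [propext h]

/-- Subtraction acts as "and not". The number `a` may be any count, so a neighbour sum can be
negated without first reducing it to its sign. -/
theorem ind_sub (P : Prop) (a : ℕ) : ind P - a = ind (P ∧ a = 0) := by
  by_cases h : P <;> by_cases h' : a = 0 <;> simp [ind, h, h']
  omega

theorem one_sub (a : ℕ) : 1 - a = ind (a = 0) := by
  by_cases h' : a = 0 <;> simp [ind, h']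
  omega

/-- An expression for the sign of a number. -/
def sgn (e : Expr) : Expr := .sub (.const 1) (.sub (.const 1) e)

/-- An expression for the truth value of an equation. -/
def eqE (e f : Expr) : Expr := .sub (.const 1) (.add (.sub e f) (.sub f e))

/-- An expression that is nonzero iff `e < f`, or `e = f` and `g` is nonzero. -/
def lexE (e f g : Expr) : Expr := .add (.sub f e) (.sub (sgn g) (.sub e f))

theorem eval_sgn (s : State) (e : Expr) : (sgn e).eval s = ind (e.eval s ≠ 0) := by
  simp only [sgn, Expr.eval, one_sub, ind_eq_zero, ne_eq]

theorem eval_eqE (s : State) (e f : Expr) : (eqE e f).eval s = ind (e.eval s = f.eval s) := by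
  simp only [eqE, Expr.eval, one_sub]
  exact ind_congr (by omega)

theorem eval_lexE (s : State) (e f g : Expr) : (lexE e f g).eval s ≠ 0 ↔
    e.eval s < f.eval s ∨ e.eval s = f.eval s ∧ g.eval s ≠ 0 := by
  simp only [lexE, Expr.eval, eval_sgn, ind_sub, Nat.add_eq_zero_iff, ind_eq_zero, ne_eq]
  omega

variable {n : ℕ} {G : SimpleGraph (Fin n)}

theorem AdjLists.sum_ind_ne_zero (L : AdjLists G) (x : Fin n) (P : Fin n → Prop) :
    ((L.nbrs x).map fun y => ind (P y)).sum ≠ 0 ↔ ∃ y, G.Adj x y ∧ P y := by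
  simp only [ne_eq, List.sum_eq_zero_iff, List.mem_map, L.mem_iff, forall_exists_index, and_imp,
    forall_apply_eq_imp_iff₂, ind_eq_zero]
  push Not
  rfl

/-- Exact domination is a count over the closed neighbourhood, hence testable in one sweep. -/
theorem AdjLists.sum_ind_eq_one (L : AdjLists G) (x : Fin n) (P : Fin n → Prop) :
    ((L.nbrs x).map fun y => ind (P y)).sum + ind (P x) = 1 ↔
      ∃! d, P d ∧ (d = x ∨ G.Adj d x) := by
  classical
  have hx : x ∉ (L.nbrs x).toFinset := by simp [L.mem_iff]
  have : ((L.nbrs x).map fun y => ind (P y)).sum + ind (P x) =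
      ((insert x (L.nbrs x).toFinset).filter P).card := by
    rw [Finset.card_filter, Finset.sum_insert hx, add_comm,
      ← List.sum_toFinset _ (L.nodup x)]
    simp only [ind]
  rw [this, Finset.card_eq_one, ExistsUnique]
  refine exists_congr fun d => ?_
  rw [Finset.eq_singleton_iff_unique_mem]
  simp only [Finset.mem_filter, Finset.mem_insert, List.mem_toFinset, L.mem_iff, G.adj_comm x,
    and_comm]

theorem AdjLists.length_add_one (L : AdjLists G) (x : Fin n) :
    (L.nbrs x).length + 1 = (closedNbhd G x).ncard := by
  classical
  have hx : x ∉ (L.nbrs x).toFinset := by simp [L.mem_iff]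
  have : closedNbhd G x = ((insert x (L.nbrs x).toFinset : Finset (Fin n)) : Set (Fin n)) := by
    ext y
    simp [closedNbhd, L.mem_iff]
  rw [this, Set.ncard_coe_finset, Finset.card_insert_of_notMem hx,
    List.toFinset_card_of_nodup (L.nodup x)]

end Indicator

/-! ### Comparing encoded weights -/

section Weights

theorem encodeWeight_eq_zero {a : ℕ∞} : encodeWeight a = 0 ↔ a = ⊤ := by
  cases a with
  | top => exact iff_of_true rfl rfl
  | coe k => simp [encodeWeight]

theorem coe_encodeWeight_sub_one {a : ℕ∞} (h : a ≠ ⊤) : ((encodeWeight a - 1 : ℕ) : ℕ∞) = a := by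
  cases a with
  | top => simp at h
  | coe k => simp [encodeWeight]

/-- Since $\infty$ is stored as 0, the order is preserved only between finite weights; keys are
compared only between candidates, where this holds. -/
theorem encodeWeight_lt {a b : ℕ∞} (ha : a ≠ ⊤) (hb : b ≠ ⊤) :
    encodeWeight a < encodeWeight b ↔ a < b := by
  cases a with
  | top => simp at ha
  | coe k =>
    cases b with
    | top => simp at hb
    | coe l => simp [encodeWeight]

theorem encodeWeight_inj {a b : ℕ∞} (ha : a ≠ ⊤) (hb : b ≠ ⊤) :
    encodeWeight a = encodeWeight b ↔ a = b := by
  cases a with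
  | top => simp at ha
  | coe k =>
    cases b with
    | top => simp at hb
    | coe l => simp [encodeWeight]

end Weights

/-! ### Local descriptions of the first three levels -/

section Levels

variable {V : Type*} {G : SimpleGraph V} {v : V}

theorem dist_le_one_iff (hc : G.Connected) {x : V} :
    G.dist v x ≤ 1 ↔ G.Adj x v ∨ x = v := by
  have := two_le_dist_iff (v := v) hc (x := x)
  rw [G.adj_comm]
  by_contra h
  rw [← Nat.lt_succ_iff, ← not_le, this] at h
  tauto

/-- A neighbour in the preceding levels and membership in none of them: this shape matches the
nested subtractions of a sweep, so no queue-based search is needed. -/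
theorem dist_eq_two_iff (hc : G.Connected) {x : V} :
    G.dist v x = 2 ↔ (∃ y, G.Adj x y ∧ G.dist v y ≤ 1) ∧ ¬ G.dist v x ≤ 1 := by
  constructor
  · intro h
    obtain ⟨y, hy, h1⟩ := exists_parent hc h
    exact ⟨⟨y, hy.symm, h1.le⟩, by omega⟩
  · rintro ⟨⟨y, hy, h1⟩, h2⟩
    have := dist_le_succ_of_adj (v := v) hc hy.symm
    omega

theorem dist_eq_three_iff (hc : G.Connected) {x : V} :
    G.dist v x = 3 ↔
      ((∃ y, G.Adj x y ∧ G.dist v y = 2) ∧ ¬ G.dist v x ≤ 1) ∧ ¬ G.dist v x = 2 := by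
  constructor
  · intro h
    obtain ⟨y, hy, h1⟩ := exists_parent hc h
    exact ⟨⟨⟨y, hy.symm, h1⟩, by omega⟩, by omega⟩
  · rintro ⟨⟨⟨y, hy, h1⟩, h2⟩, h3⟩
    have := dist_le_succ_of_adj (v := v) hc hy.symm
    omega

end Levels

/-! ### The five sweeps: levels, candidates, selection, verification -/

section Passes

/-- The entry of array `a` at the current vertex. -/
def atX (a : ℕ) : Expr := .read a (.var 3)

/-- The entry of array `a` at the current neighbour. -/
def atY (a : ℕ) : Expr := .read a (.var 6)

def degX : Expr := .sub (.read 1 (.add (.var 3) (.const 1))) (.read 1 (.var 3))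

def degY : Expr := .sub (.read 1 (.add (.var 6) (.const 1))) (.read 1 (.var 6))

/-- Mark the closed neighbourhood of the vertex `var 1` in the array `out`. -/
def nearPass (out : ℕ) : Prog :=
  pass out (eqE (.var 6) (.var 1)) (sgn (.add (.var 7) (eqE (.var 3) (.var 1))))

/-- From here on array 5 marks $N[v]$, 6 marks $N_2$, 7 the candidates, 8 the selection, and 9 the
vertices at distance at least two that are not dominated exactly once. -/
def secondPass : Prog := pass 6 (atY 5) (.sub (sgn (.var 7)) (atX 5))

def candPass : Prog :=
  pass 7 (atY 6) (.sub (.sub (.sub (sgn (.var 7)) (atX 5)) (atX 6)) (.sub (.const 1) (atX 0)))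

/-- Nonzero when the current neighbour has a better key than the current vertex, provided both
weights are finite. -/
def beatsE : Expr :=
  lexE degX degY (lexE (atY 0) (atX 0) (.sub (.var 3) (.var 6)))

def selPass : Prog :=
  pass 8 (.sub (sgn beatsE) (.sub (.const 1) (atY 7))) (.sub (atX 7) (.var 7))

def badPass : Prog :=
  pass 9 (atY 8)
    (.sub (.sub (.const 1) (eqE (.add (.var 7) (atX 8)) (.const 1))) (atX 5))

variable {n : ℕ} {G : SimpleGraph (Fin n)} [DecidableRel G.Adj] {L : AdjLists G} {w : Fin n → ℕ∞}
  {s : State} {v : Fin n}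

theorem runs_nearPass (hc : G.Connected) {out : ℕ} (hout : 3 ≤ out) (hL : Loaded L w s)
    (h1 : s.var 1 = v) :
    Runs (nearPass out) s (100 * (n + 2 * G.edgeFinset.card + 1)) fun s' =>
      SameOff out s s' ∧ ∀ x : Fin n, s'.arr out x = ind (G.dist v x ≤ 1) := by
  refine (runs_pass hL hout (fun _ y => ind (y = v)) (fun x => ind (G.dist v x ≤ 1)) ?_ ?_).mono
    (Nat.mul_le_mul_right _ (by simp [Expr.cost, eqE, sgn])) fun _ h => h
  · intro x y s' hs h3 h6
    simp only [eval_eqE, Expr.eval, h6, hs.1 1 (by decide), h1]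
    exact ind_congr Fin.val_inj
  · intro x s' hs h3 h7
    simp only [eval_sgn, eval_eqE, Expr.eval, h3, hs.1 1 (by decide), h1]
    have hadd : ∀ a b : ℕ, a + b ≠ 0 ↔ a ≠ 0 ∨ b ≠ 0 := by omega
    refine ind_congr ?_
    rw [dist_le_one_iff hc, hadd, ind_ne_zero, h7,
      L.sum_ind_ne_zero, Fin.val_inj]
    simp

theorem runs_secondPass (hc : G.Connected) (hL : Loaded L w s)
    (h5 : ∀ x : Fin n, s.arr 5 x = ind (G.dist v x ≤ 1)) :
    Runs secondPass s (100 * (n + 2 * G.edgeFinset.card + 1)) fun s' =>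
      SameOff 6 s s' ∧ ∀ x : Fin n, s'.arr 6 x = ind (G.dist v x = 2) := by
  refine (runs_pass hL (by norm_num) (fun _ y => ind (G.dist v y ≤ 1))
    (fun x => ind (G.dist v x = 2)) ?_ ?_).mono
    (Nat.mul_le_mul_right _ (by simp [Expr.cost, atY, atX, sgn])) fun _ h => h
  · intro x y s' hs h3 h6
    simp only [atY, Expr.eval, h6, hs.2 5 (by decide), h5]
  · intro x s' hs h3 h7
    simp only [eval_sgn, atX, Expr.eval, h3, hs.2 5 (by decide), h5, ind_sub, ind_eq_zero]
    refine ind_congr ?_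
    rw [dist_eq_two_iff hc, h7, L.sum_ind_ne_zero]

theorem runs_candPass (hc : G.Connected) (hL : Loaded L w s)
    (h5 : ∀ x : Fin n, s.arr 5 x = ind (G.dist v x ≤ 1))
    (h6 : ∀ x : Fin n, s.arr 6 x = ind (G.dist v x = 2)) :
    Runs candPass s (100 * (n + 2 * G.edgeFinset.card + 1)) fun s' =>
      SameOff 7 s s' ∧ ∀ x : Fin n, s'.arr 7 x = ind (x ∈ candidates G w v) := by
  refine (runs_pass hL (by norm_num) (fun _ y => ind (G.dist v y = 2))
    (fun x => ind (x ∈ candidates G w v)) ?_ ?_).mono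
    (Nat.mul_le_mul_right _ (by simp [Expr.cost, atY, atX, sgn])) fun _ h => h
  · intro x y s' hs h3 hy
    simp only [atY, Expr.eval, hy, hs.2 6 (by decide), h6]
  · intro x s' hs h3 h7
    simp only [eval_sgn, atX, Expr.eval, h3, hs.2 5 (by decide), h5, hs.2 6 (by decide), h6,
      hs.2 0 (by decide), hL.weights, ind_sub, one_sub, ind_eq_zero]
    refine ind_congr ?_
    rw [h7, L.sum_ind_ne_zero, ← dist_eq_three_iff hc, encodeWeight_eq_zero]
    rfl

theorem runs_selPass (hL : Loaded L w s)
    (hcand : ∀ x : Fin n, s.arr 7 x = ind (x ∈ candidates G w v)) :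
    Runs selPass s (100 * (n + 2 * G.edgeFinset.card + 1)) fun s' =>
      SameOff 8 s s' ∧ ∀ x : Fin n, s'.arr 8 x =
        ind (x ∈ selection G w (fun x => (L.nbrs x).length) v) := by
  refine (runs_pass hL (by norm_num) (fun x y => ind (((L.nbrs x).length < (L.nbrs y).length ∨
      (L.nbrs x).length = (L.nbrs y).length ∧ (encodeWeight (w y) < encodeWeight (w x) ∨
        encodeWeight (w y) = encodeWeight (w x) ∧ y < x)) ∧ y ∈ candidates G w v))
    (fun x => ind (x ∈ selection G w (fun x => (L.nbrs x).length) v)) ?_ ?_).mono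
    -- This sweep dictates the common constant 100: its expressions cost 64 and 4, and the overhead
    -- is 30.
    (Nat.mul_le_mul_right _ (by simp [Expr.cost, atY, atX, sgn, beatsE, lexE, degX, degY]))
    fun _ h => h
  · intro x y s' hs h3 hy
    have h0 : s'.arr 0 = s.arr 0 := hs.2 0 (by decide)
    have h1 : s'.arr 1 = s.arr 1 := hs.2 1 (by decide)
    have hd : ∀ z : Fin n, s.arr 1 (z + 1) - s.arr 1 z = (L.nbrs z).length := by
      intro z
      rw [hL.offsets _ z.2, hL.offsets _ z.2.le, L.offset_succ, Nat.add_sub_cancel_left]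
    simp only [Expr.eval, eval_sgn, beatsE, eval_lexE, ind_sub, one_sub, atX, atY, degX, degY, hy,
      h3, hs.2 7 (by decide), h0, h1, hcand, hd, hL.weights, ind_eq_zero, not_not]
    refine ind_congr ?_
    rw [Fin.lt_def, ← Nat.sub_ne_zero_iff_lt (m := (y : ℕ))]
  · intro x s' hs h3 h7
    simp only [atX, Expr.eval, h3, hs.2 7 (by decide), hcand, ind_sub]
    refine ind_congr (and_congr_right fun hx => ?_)
    rw [h7, ← not_iff_not, ← ne_eq, L.sum_ind_ne_zero]
    push Not
    refine exists_congr fun y => and_congr_right fun _ => ?_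
    rw [and_comm]
    refine and_congr_right fun hy => ?_
    rw [selKey_lt_iff, encodeWeight_lt hy.2 hx.2, encodeWeight_inj hy.2 hx.2, eq_comm]

theorem runs_badPass (hL : Loaded L w s) {P : Fin n → Prop}
    (h5 : ∀ x : Fin n, s.arr 5 x = ind (G.dist v x ≤ 1)) (h8 : ∀ x : Fin n, s.arr 8 x = ind (P x)) :
    Runs badPass s (100 * (n + 2 * G.edgeFinset.card + 1)) fun s' =>
      SameOff 9 s s' ∧ ∀ x : Fin n, s'.arr 9 x =
        ind (2 ≤ G.dist v x ∧ ¬ ∃! d, P d ∧ (d = x ∨ G.Adj d x)) := by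
  refine (runs_pass hL (by norm_num) (fun _ y => ind (P y))
    (fun x => ind (2 ≤ G.dist v x ∧ ¬ ∃! d, P d ∧ (d = x ∨ G.Adj d x))) ?_ ?_).mono
    (Nat.mul_le_mul_right _ (by simp [Expr.cost, atY, atX, eqE])) fun _ h => h
  · intro x y s' hs h3 hy
    simp only [atY, Expr.eval, hy, hs.2 8 (by decide), h8]
  · intro x s' hs h3 h7
    simp only [eval_eqE, atX, Expr.eval, h3, hs.2 5 (by decide), h5, hs.2 8 (by decide), h8,
      ind_sub, one_sub, ind_eq_zero]
    refine ind_congr ?_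
    rw [h7, L.sum_ind_eq_one, and_comm, not_le]
    rfl

end Passes

/-! ### Computing and verifying the selection -/

section Solve

def tallyBody : Prog :=
  .seq (.assign 11 (.add (.var 11) (.read 9 (.var 13))))
    (.seq (.ite (.read 8 (.var 13))
      (.assign 12 (.add (.var 12) (.sub (.read 0 (.var 13)) (.const 1)))) .skip)
      (.assign 13 (.add (.var 13) (.const 1))))

/-- Add up the array `9` in `var 11` and the weights of the vertices marked in the array `8` in
`var 12`. -/
def tally : Prog :=
  .seq (.assign 11 (.const 0)) (.seq (.assign 12 (.const 0)) (.seq (.assign 13 (.const 0))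
    (.while (.sub (.var 0) (.var 13)) tallyBody)))

/-- Compute the selection for the vertex `var 1` and check whether it is an efficient dominating
set of the vertices at distance at least two. -/
def solve : Prog :=
  .seq (nearPass 5) (.seq secondPass (.seq candPass (.seq selPass (.seq badPass tally))))

variable {n : ℕ} {G : SimpleGraph (Fin n)} {L : AdjLists G} {w : Fin n → ℕ∞}
  {s : State} {v : Fin n}

open Classical in
theorem runs_tally (hL : Loaded L w s) {P B : Fin n → Prop} (hP : ∀ x, P x → w x ≠ ⊤)
    (h8 : ∀ x : Fin n, s.arr 8 x = ind (P x)) (h9 : ∀ x : Fin n, s.arr 9 x = ind (B x)) :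
    Runs tally s (30 * (n + 1)) fun s' =>
      (∀ z, z ∉ ({11, 12, 13} : Finset ℕ) → s'.var z = s.var z) ∧ s'.arr = s.arr ∧
      (s'.var 11 = 0 ↔ ∀ x, ¬ B x) ∧
      (s'.var 12 : ℕ∞) = weight w (Finset.univ.filter P) := by
  have := Runs.loop (i := 13) (h := 0) (b := n) (p := tallyBody)
    (fun k s' => (s'.var 13 = k ∧ s'.var 0 = n) ∧
      (∀ z, z ∉ ({11, 12, 13} : Finset ℕ) → s'.var z = s.var z) ∧ s'.arr = s.arr ∧
      (s'.var 11 = 0 ↔ ∀ x : Fin n, x < k → ¬ B x) ∧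
      (s'.var 12 : ℕ∞) = weight w (Finset.univ.filter fun x : Fin n => x < k ∧ P x))
    (fun _ => 22) (fun k s' h => h.1) (a := 0) (Nat.zero_le n) ?_
    (s := ((s.setVar 11 0).setVar 12 0).setVar 13 0) ?_
  · refine Runs.mono (.seq (.assign (Q := fun s' => s' = s.setVar 11 0) rfl) fun s₁ h₁ =>
      .seq (.assign (Q := fun s' => s' = (s.setVar 11 0).setVar 12 0) (by rw [h₁]; rfl))
      fun s₂ h₂ => .seq (.assign (Q := fun s' => s' = ((s.setVar 11 0).setVar 12 0).setVar 13 0)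
      (by rw [h₂]; rfl)) fun s₃ h₃ => h₃ ▸ this) ?_ ?_
    · simp only [Finset.sum_const, Nat.card_Ico, smul_eq_mul, Expr.cost]
      omega
    · rintro s' ⟨-, h1, h2, h3, h4⟩
      refine ⟨h1, h2, ?_, ?_⟩
      · rw [h3]
        exact ⟨fun h x => h x x.2, fun h x _ => h x⟩
      · rw [h4]
        congr 1
        ext x
        simp
  · rintro k s' - hk ⟨⟨h13, h0⟩, hvar, harr, h11, h12⟩
    have e8 : s'.arr 8 k = ind (P ⟨k, hk⟩) := by rw [harr]; exact h8 ⟨k, hk⟩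
    have e9 : s'.arr 9 k = ind (B ⟨k, hk⟩) := by rw [harr]; exact h9 ⟨k, hk⟩
    have e0 : s'.arr 0 k = encodeWeight (w ⟨k, hk⟩) := by rw [harr]; exact hL.weights ⟨k, hk⟩
    unfold tallyBody
    refine Runs.mono (.seq (.assign (Q := fun t => t = s'.setVar 11 (s'.var 11 + ind (B ⟨k, hk⟩)))
      ?_) fun s₁ h₁ => .seq (.ite (T := 7) (Q := fun t => (t.arr = s'.arr ∧
        ∀ z, z ≠ 12 → t.var z = s₁.var z) ∧ (t.var 12 : ℕ∞) = weight w
          (Finset.univ.filter fun x : Fin n => x < k + 1 ∧ P x)) ?_ ?_)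
        fun s₂ h₂ => .assign ?_) ?_ (fun _ h => h)
    · simp [Expr.eval, h13, e9]
    · subst h₁
      intro hne
      have hPk : P ⟨k, hk⟩ := by
        simpa [Expr.eval, h13, e8, ind_eq_zero] using hne
      refine Runs.mono (.assign ⟨⟨rfl, fun z hz => ?_⟩, ?_⟩) (by simp [Expr.cost]) (fun _ h => h)
      · simp [hz]
      · have : (Finset.univ.filter fun x : Fin n => x < k + 1 ∧ P x) =
            insert ⟨k, hk⟩ (Finset.univ.filter fun x : Fin n => x < k ∧ P x) := by
          ext x
          simp only [Finset.mem_filter, Finset.mem_univ, true_and, Finset.mem_insert]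
          constructor
          · rintro ⟨h1, h2⟩
            rcases Nat.lt_succ_iff_lt_or_eq.1 h1 with h | h
            · exact Or.inr ⟨h, h2⟩
            · exact Or.inl (Fin.ext h)
          · rintro (rfl | h)
            · exact ⟨Nat.lt_succ_self _, hPk⟩
            · exact ⟨by omega, h.2⟩
        rw [weight, this, Finset.sum_insert (by simp)]
        rw [weight] at h12
        rw [← h12, ← coe_encodeWeight_sub_one (hP _ hPk)]
        simp [Expr.eval, h13, e0, add_comm]
    · subst h₁
      intro hne
      have hPk : ¬ P ⟨k, hk⟩ := by
        simpa [Expr.eval, h13, e8, ind_eq_zero] using hne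
      refine (Runs.skip ⟨⟨rfl, fun z hz => rfl⟩, ?_⟩).mono (by norm_num) (fun _ h => h)
      have : (Finset.univ.filter fun x : Fin n => x < k + 1 ∧ P x) =
          (Finset.univ.filter fun x : Fin n => x < k ∧ P x) := by
        ext x
        simp only [Finset.mem_filter, Finset.mem_univ, true_and]
        refine and_congr_left fun hx => ⟨fun h => ?_, fun h => by omega⟩
        rcases Nat.lt_succ_iff_lt_or_eq.1 h with h | h
        · exact h
        · exact absurd ((Fin.ext h : x = ⟨k, hk⟩) ▸ hx) hPk
      rw [this, ← h12]
      simp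
    · obtain ⟨⟨ha, hv⟩, h12'⟩ := h₂
      subst h₁
      refine ⟨⟨?_, ?_⟩, fun z hz => ?_, ?_, ?_, ?_⟩
      · simp [Expr.eval, hv, h13]
      · simp [hv, h0]
      · rw [← hvar z hz]
        simp only [Finset.mem_insert, Finset.mem_singleton, not_or] at hz
        simp [hv, hz]
      · simp [ha, harr]
      · have e11 : s₂.var 11 = s'.var 11 + ind (B ⟨k, hk⟩) := by simp [hv]
        simp only [State.setVar_var, show (11 : ℕ) ≠ 13 by norm_num, if_false, e11,
          Nat.add_eq_zero_iff, h11, ind_eq_zero]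
        constructor
        · rintro ⟨h1, h2⟩ x hx
          rcases Nat.lt_succ_iff_lt_or_eq.1 hx with h | h
          · exact h1 x h
          · exact (Fin.ext h : x = ⟨k, hk⟩) ▸ h2
        · exact fun h => ⟨fun x hx => h x (by omega), h _ (Nat.lt_succ_self k)⟩
      · simpa using h12'
    · simp only [Expr.cost]
      norm_num
  · refine ⟨⟨by simp, by simp [hL.size]⟩, fun z hz => ?_, rfl, by simp, ?_⟩
    · simp only [Finset.mem_insert, Finset.mem_singleton, not_or] at hz
      simp [hz]
    · simp [weight]

/-- The selection for `v`, computed from adjacency lists. -/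
def AdjLists.sel (L : AdjLists G) (w : Fin n → ℕ∞) (v : Fin n) : Set (Fin n) :=
  selection G w (fun x => (L.nbrs x).length) v

open Classical in
/-- The selection as a finite set. -/
noncomputable def AdjLists.selFinset (L : AdjLists G) (w : Fin n → ℕ∞) (v : Fin n) :
    Finset (Fin n) := Finset.univ.filter fun x => x ∈ L.sel w v

theorem AdjLists.mem_selFinset {x : Fin n} : x ∈ L.selFinset w v ↔ x ∈ L.sel w v := by
  simp [AdjLists.selFinset]

theorem AdjLists.coe_selFinset : (L.selFinset w v : Set (Fin n)) = L.sel w v := by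
  ext x
  exact AdjLists.mem_selFinset

/-- The effect of the program `solve`. -/
structure Solved (L : AdjLists G) (w : Fin n → ℕ∞) (v : Fin n) (s s' : State) : Prop where
  vars : ∀ z, z ∉ ({3, 4, 5, 6, 7, 11, 12, 13} : Finset ℕ) → s'.var z = s.var z
  arrs : ∀ a, a ∉ ({5, 6, 7, 8, 9} : Finset ℕ) → s'.arr a = s.arr a
  sel : ∀ x : Fin n, s'.arr 8 x = ind (x ∈ L.sel w v)
  ok : s'.var 11 = 0 ↔ IsFarED G v (L.sel w v)
  total : (s'.var 12 : ℕ∞) = weight w (L.selFinset w v)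

theorem Solved.loaded {s' : State} (h : Solved L w v s s') (hL : Loaded L w s) : Loaded L w s' :=
  hL.of_eq (h.vars 0 (by decide)) (h.arrs 0 (by decide)) (h.arrs 1 (by decide))
    (h.arrs 2 (by decide))

theorem SameOff.loaded {out : ℕ} {s' : State} (h : SameOff out s s') (hout : 3 ≤ out)
    (hL : Loaded L w s) : Loaded L w s' :=
  hL.of_eq (h.1 0 (by decide)) (h.2 0 (by omega)) (h.2 1 (by omega)) (h.2 2 (by omega))

/-- Only connectedness is needed: the outcome of the check is exact whether or not the graph
contains forbidden subgraphs. The 600 covers five sweeps at 100 each and the tally. -/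
theorem runs_solve [DecidableRel G.Adj] (hc : G.Connected) (hL : Loaded L w s) (h1 : s.var 1 = v) :
    Runs solve s (600 * (n + 2 * G.edgeFinset.card + 1)) (Solved L w v s) := by
  refine Runs.mono (.seq (runs_nearPass hc (by norm_num) hL h1) fun s₁ h₁ =>
    have L₁ := h₁.1.loaded (by norm_num) hL
    .seq (runs_secondPass hc L₁ h₁.2) fun s₂ h₂ =>
    have L₂ := h₂.1.loaded (by norm_num) L₁
    have n₂ : ∀ x : Fin n, s₂.arr 5 x = ind (G.dist v x ≤ 1) := by
      rw [h₂.1.2 5 (by decide)]; exact h₁.2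
    .seq (runs_candPass hc L₂ n₂ h₂.2) fun s₃ h₃ =>
    have L₃ := h₃.1.loaded (by norm_num) L₂
    have n₃ : ∀ x : Fin n, s₃.arr 5 x = ind (G.dist v x ≤ 1) := by
      rw [h₃.1.2 5 (by decide)]; exact n₂
    .seq (runs_selPass L₃ h₃.2) fun s₄ h₄ =>
    have L₄ := h₄.1.loaded (by norm_num) L₃
    have n₄ : ∀ x : Fin n, s₄.arr 5 x = ind (G.dist v x ≤ 1) := by
      rw [h₄.1.2 5 (by decide)]; exact n₃
    .seq (runs_badPass L₄ n₄ h₄.2) fun s₅ h₅ =>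
    have L₅ := h₅.1.loaded (by norm_num) L₄
    have n₅ : ∀ x : Fin n, s₅.arr 8 x = ind (x ∈ L.sel w v) := by
      rw [h₅.1.2 8 (by decide)]; exact h₄.2
    (runs_tally L₅ (fun x hx => hx.1.2) n₅ h₅.2).mono le_rfl
      (Q' := Solved L w v s) fun s₆ h₆ => ?_) (by omega) fun _ h => h
  obtain ⟨hv, ha, h11, h12⟩ := h₆
  refine ⟨fun z hz => ?_, fun a ha' => ?_, ?_, ?_, h12⟩
  · simp only [Finset.mem_insert, Finset.mem_singleton, not_or] at hz
    rw [hv z (by simp [hz]), h₅.1.1 z (by simp [hz]), h₄.1.1 z (by simp [hz]),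
      h₃.1.1 z (by simp [hz]), h₂.1.1 z (by simp [hz]), h₁.1.1 z (by simp [hz])]
  · simp only [Finset.mem_insert, Finset.mem_singleton, not_or] at ha'
    rw [ha, h₅.1.2 a (by simp [ha']), h₄.1.2 a (by simp [ha']),
      h₃.1.2 a (by simp [ha']), h₂.1.2 a (by simp [ha']), h₁.1.2 a (by simp [ha'])]
  · rw [ha]
    exact n₅
  · rw [h11]
    constructor
    -- Selected vertices lie in $N_3$ by construction, so only domination has to be checked.
    · exact fun h => ⟨fun d hd => hd.1.1, fun x hx => by_contra fun h' => h x ⟨hx, h'⟩⟩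
    · exact fun h x hx => hx.2 (h.2 x hx.1)

end Solve

/-! ### The robust algorithm for $G_v$ -/

section Far

variable {n : ℕ} {G : SimpleGraph (Fin n)} {L : AdjLists G} {w : Fin n → ℕ∞} {v : Fin n}

/-- The algorithm for the graph without the closed neighbourhood of `var 1`. -/
def solveFar : Prog :=
  .seq solve (.seq (pass 3 (.const 0) (sgn (atX 8))) (.assign 2 (.sub (.const 1) (.var 11))))

theorem card_le_card_edgeFinset_add_one [DecidableRel G.Adj] (hc : G.Connected) :
    n ≤ G.edgeFinset.card + 1 := by
  have := hc.card_vert_le_card_edgeSet_add_one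
  rwa [Nat.card_eq_fintype_card, Fintype.card_fin, Nat.card_eq_fintype_card,
    ← SimpleGraph.edgeFinset_card] at this

theorem runs_solveFar [DecidableRel G.Adj] (hc : G.Connected) :
    Runs solveFar (input L w v) (4000 * max 1 G.edgeFinset.card) fun s =>
      (s.found ↔ IsFarED G v (L.sel w v)) ∧ s.outSet n = L.selFinset w v := by
  have hL := loaded_input L w v
  have hn := card_le_card_edgeFinset_add_one hc
  refine Runs.mono (.seq (runs_solve (v := v) hc hL (by simp [input])) fun s₁ h₁ =>
    .seq (runs_pass (h₁.loaded hL) (by norm_num) (fun _ _ => 0) (fun x => ind (x ∈ L.sel w v))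
      (fun _ _ _ _ _ _ => rfl) ?eval) fun s₂ h₂ => .assign ?result) ?time fun _ h => h
  case eval =>
    intro x s' hs h3 _
    simp only [eval_sgn, atX, Expr.eval, h3, hs.2 8 (by decide), h₁.sel, ind_ne_zero]
  case result =>
    refine ⟨?_, ?_⟩
    · rw [← h₁.ok, State.found]
      simp only [State.setVar_var, if_true, Expr.eval, h₂.1.1 11 (by decide)]
      omega
    · ext x
      rw [AdjLists.mem_selFinset, State.outSet, Finset.mem_filter, State.setVar_arr, h₂.2,
        ind_ne_zero]
      simp
  case time =>
    simp only [Expr.cost, sgn, atX]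
    omega

theorem mem_farSet (hc : G.Connected) {x : Fin n} : x ∈ farSet G v ↔ 2 ≤ G.dist v x :=
  (two_le_dist_iff hc).symm

theorem isED_induce_iff (hc : G.Connected) {D : Finset (farSet G v)} {S : Finset (Fin n)}
    (hS : S = D.map (Function.Embedding.subtype _)) :
    IsED (G.induce (farSet G v)) (D : Set (farSet G v)) ↔
      ∀ x, 2 ≤ G.dist v x → ∃! d, d ∈ S ∧ (d = x ∨ G.Adj d x) := by
  subst hS
  have key : ∀ (x : Fin n) (hx : x ∈ farSet G v), (∃! d : farSet G v, d ∈ (D : Set (farSet G v)) ∧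
      (d = ⟨x, hx⟩ ∨ (G.induce (farSet G v)).Adj d ⟨x, hx⟩)) ↔
      ∃! d, d ∈ D.map (Function.Embedding.subtype _) ∧ (d = x ∨ G.Adj d x) := by
    intro x hx
    constructor
    · rintro ⟨d, ⟨hd, hdx⟩, huniq⟩
      refine ⟨d, ⟨Finset.mem_map_of_mem _ hd, by simpa [Subtype.ext_iff] using hdx⟩, ?_⟩
      rintro e ⟨he, hex⟩
      obtain ⟨e, he', rfl⟩ := Finset.mem_map.1 he
      exact congrArg Subtype.val (huniq e ⟨he', by simpa [Subtype.ext_iff] using hex⟩)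
    · rintro ⟨d, ⟨hd, hdx⟩, huniq⟩
      obtain ⟨d, hd', rfl⟩ := Finset.mem_map.1 hd
      refine ⟨d, ⟨hd', by simpa [Subtype.ext_iff] using hdx⟩, ?_⟩
      rintro e ⟨he, hex⟩
      exact Subtype.ext (huniq e ⟨Finset.mem_map_of_mem _ he,
        by simpa [Subtype.ext_iff] using hex⟩)
  constructor
  · exact fun h x hx => (key x ((mem_farSet hc).2 hx)).1 (h _)
  · exact fun h x => (key x x.2).2 (h x ((mem_farSet hc).1 x.2))

theorem weight_farSet {D : Finset (farSet G v)} {S : Finset (Fin n)}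
    (hS : S = D.map (Function.Embedding.subtype _)) :
    weight (fun x : farSet G v => w x) D = weight w S := by
  subst hS
  simp [weight]

/-- Finite weight excludes $N_2$ and $N_4$, and freeness excludes distances above four, so only
$N_3$ remains. -/
theorem isFarED_of_weight_lt_top (hc : G.Connected) (hG : P6S122Free G)
    (hw : ∀ x ∈ level G v 2 ∪ level G v 4, w x = ⊤) {D : Finset (farSet G v)}
    (hD : IsED (G.induce (farSet G v)) (D : Set (farSet G v)))
    (hlt : weight (fun x : farSet G v => w x) D < ⊤) :
    IsFarED G v (D.map (Function.Embedding.subtype _) : Finset (Fin n)) ∧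
      ∀ d ∈ D.map (Function.Embedding.subtype _), w d ≠ ⊤ := by
  have hfin : ∀ d ∈ D.map (Function.Embedding.subtype _), w d ≠ ⊤ := by
    intro d hd htop
    rw [weight_farSet rfl] at hlt
    have := Finset.single_le_sum (f := w) (fun _ _ => zero_le) hd
    rw [htop] at this
    exact absurd hlt (not_lt.2 this)
  refine ⟨⟨fun d hd => ?_, fun x hx => ?_⟩, hfin⟩
  · have h4 := hG.dist_le_four (v := v) hc d
    have hd' := hd
    obtain ⟨e, he, rfl⟩ := Finset.mem_map.1 (Finset.mem_coe.1 hd')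
    have h2 := (mem_farSet hc).1 e.2
    have := mt (hw e) (hfin e hd)
    simp only [level, Set.mem_union, Set.mem_ofPred_eq, not_or] at this
    change G.dist v (e : Fin n) = 3
    change G.dist v (e : Fin n) ≤ 4 at h4
    omega
  · simpa using (isED_induce_iff hc rfl).1 hD x hx

theorem isMinED_selFinset (hc : G.Connected) (hG : P6S122Free G)
    (hw : ∀ x ∈ level G v 2 ∪ level G v 4, w x = ⊤) {D : Finset (farSet G v)}
    (hS : L.selFinset w v = D.map (Function.Embedding.subtype _))
    (hsel : IsFarED G v (L.sel w v)) :
    IsMinED (G.induce (farSet G v)) (fun x => w x) D := by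
  refine ⟨(isED_induce_iff hc hS).2 fun x hx => ?_, fun D' hD' => ?_⟩
  · simpa [AdjLists.mem_selFinset] using hsel.2 x hx
  -- A competitor of infinite weight is harmless; one of finite weight is a far e.d., to which the
  -- exchange argument applies.
  · by_cases htop : weight (fun x : farSet G v => w x) D' = ⊤
    · rw [htop]
      exact le_top
    · obtain ⟨h1, h2⟩ := isFarED_of_weight_lt_top hc hG hw hD' (lt_top_iff_ne_top.2 htop)
      rw [weight_farSet hS, weight_farSet rfl]
      exact h1.weight_selection_le hc hG L.length_add_one (fun d hd => h2 d hd)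
        AdjLists.coe_selFinset

theorem solveFar_correct [DecidableRel G.Adj] (hc : G.Connected)
    (hw : ∀ x ∈ level G v 2 ∪ level G v 4, w x = ⊤) :
    ∃ (s : State) (t : ℕ), Exec solveFar (input L w v) s t ∧
      t ≤ 4000 * max 1 G.edgeFinset.card ∧
      (s.found → ∃ D : Finset (farSet G v),
        s.outSet n = D.map (Function.Embedding.subtype _) ∧
        IsED (G.induce (farSet G v)) (D : Set (farSet G v)) ∧
        weight (fun x : farSet G v => w x) D < ⊤ ∧
        (P6S122Free G → IsMinED (G.induce (farSet G v)) (fun x => w x) D)) ∧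
      (¬ s.found → ¬ P6S122Free G ∨
        ¬ ∃ D : Finset (farSet G v), IsED (G.induce (farSet G v)) (D : Set (farSet G v)) ∧
          weight (fun x : farSet G v => w x) D < ⊤) := by
  classical
  obtain ⟨s, t, he, ht, hf, hout⟩ := runs_solveFar (L := L) (w := w) (v := v) hc
  refine ⟨s, t, he, ht, fun h => ?_, fun h => ?_⟩
  · have hsel := hf.1 h
    have hS : L.selFinset w v = ((L.selFinset w v).subtype (· ∈ farSet G v)).map
        (Function.Embedding.subtype _) := by
      rw [Finset.subtype_map_of_mem]
      intro x hx
      rw [mem_farSet hc, hsel.1 x (AdjLists.mem_selFinset.1 hx)]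
      norm_num
    refine ⟨_, hout.trans hS, (isED_induce_iff hc hS).2 fun x hx => ?_, ?_, fun hG =>
      isMinED_selFinset hc hG hw hS hsel⟩
    · simpa [AdjLists.mem_selFinset] using hsel.2 x hx
    · rw [weight_farSet hS, weight]
      exact WithTop.sum_lt_top.2 fun x hx => lt_top_iff_ne_top.2 (AdjLists.mem_selFinset.1 hx).1.2
  · by_contra! hcon
    obtain ⟨hG, D, hD, hlt⟩ := hcon
    obtain ⟨h1, h2⟩ := isFarED_of_weight_lt_top hc hG hw hD hlt
    exact h (hf.2 (h1.isFarED_selection hc hG L.length_add_one fun d hd => h2 d hd))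

end Far

/-! ### Minimum weight over the closed neighbourhood of a minimum-degree vertex -/

section Optimum

variable {n : ℕ} {G : SimpleGraph (Fin n)} {L : AdjLists G} {w : Fin n → ℕ∞}
  {s : State} {v : Fin n}

/-- The degree of the vertex whose number is in the variable `z`. -/
def degAt (z : ℕ) : Expr := .sub (.read 1 (.add (.var z) (.const 1))) (.read 1 (.var z))

theorem Loaded.eval_degAt (hL : Loaded L w s) {z : ℕ} {x : Fin n} (h : s.var z = x) :
    (degAt z).eval s = (L.nbrs x).length := by
  simp only [degAt, Expr.eval, h]
  rw [hL.offsets _ x.2, hL.offsets _ x.2.le, L.offset_succ, Nat.add_sub_cancel_left]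

def argminBody : Prog :=
  .seq (.ite (.sub (degAt 1) (degAt 14)) (.assign 1 (.var 14)) .skip)
    (.assign 14 (.add (.var 14) (.const 1)))

/-- Put a vertex of minimum degree into `var 1`. -/
def argmin : Prog :=
  .seq (.assign 14 (.const 0)) (.while (.sub (.var 0) (.var 14)) argminBody)

theorem runs_argmin (hL : Loaded L w s) (hv : s.var 1 = v) :
    Runs argmin s (40 * (n + 1)) fun s' =>
      (∀ z, z ∉ ({1, 14} : Finset ℕ) → s'.var z = s.var z) ∧ s'.arr = s.arr ∧
        ∃ u : Fin n, s'.var 1 = u ∧ ∀ y, (L.nbrs u).length ≤ (L.nbrs y).length := by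
  have := Runs.loop (i := 14) (h := 0) (b := n) (p := argminBody)
    (fun k s' => (s'.var 14 = k ∧ s'.var 0 = n) ∧
      (∀ z, z ∉ ({1, 14} : Finset ℕ) → s'.var z = s.var z) ∧ s'.arr = s.arr ∧
      ∃ u : Fin n, s'.var 1 = u ∧ ∀ y : Fin n, y < k → (L.nbrs u).length ≤ (L.nbrs y).length)
    (fun _ => 22) (fun k s' h => h.1) (a := 0) (Nat.zero_le n) ?_ (s := s.setVar 14 0) ?_
  · refine Runs.mono (.seq (.assign (Q := fun s' => s' = s.setVar 14 0) rfl) fun s₁ h₁ =>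
      h₁ ▸ this) ?_ ?_
    · simp only [Finset.sum_const, Nat.card_Ico, smul_eq_mul, Expr.cost]
      omega
    · rintro s' ⟨-, h1, h2, u, hu, h3⟩
      exact ⟨h1, h2, u, hu, fun y => h3 y y.2⟩
  · rintro k s' - hk ⟨⟨h14, h0⟩, hvar, harr, u, hu, hmin⟩
    have L' : Loaded L w s' := hL.of_eq (hvar 0 (by decide)) (by rw [harr]) (by rw [harr])
      (by rw [harr])
    have e1 := L'.eval_degAt hu
    have e2 := L'.eval_degAt (x := ⟨k, hk⟩) h14
    unfold argminBody
    refine Runs.mono (.seq (.ite (T := 2) (Q := fun t => t.arr = s'.arr ∧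
        (∀ z, z ≠ 1 → t.var z = s'.var z) ∧ ∃ u : Fin n, t.var 1 = u ∧
          ∀ y : Fin n, y < k + 1 → (L.nbrs u).length ≤ (L.nbrs y).length) ?_ ?_)
        fun s₂ h₂ => .assign ?_) ?_ (fun _ h => h)
    · intro hne
      simp only [Expr.eval, e1, e2] at hne
      refine .assign ⟨rfl, fun z hz => by simp [hz], ⟨k, hk⟩, by simp [Expr.eval, h14], ?_⟩
      intro y hy
      rcases Nat.lt_succ_iff_lt_or_eq.1 hy with h | h
      · have := hmin y h
        omega
      · rw [(Fin.ext h : y = ⟨k, hk⟩)]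
    · intro hne
      simp only [Expr.eval, e1, e2] at hne
      refine (Runs.skip ⟨rfl, fun z _ => rfl, u, hu, ?_⟩).mono (by norm_num) (fun _ h => h)
      intro y hy
      rcases Nat.lt_succ_iff_lt_or_eq.1 hy with h | h
      · exact hmin y h
      · rw [(Fin.ext h : y = ⟨k, hk⟩)]
        omega
    · obtain ⟨ha, hv', u', hu', hmin'⟩ := h₂
      refine ⟨⟨by simp [Expr.eval, hv', h14], by simp [hv', h0]⟩, fun z hz => ?_,
        by simp [ha, harr], u', by simp [hu'], hmin'⟩
      rw [← hvar z hz]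
      simp only [Finset.mem_insert, Finset.mem_singleton, not_or] at hz
      simp [hv', hz]
    · simp only [Expr.cost, degAt]
      norm_num
  · refine ⟨⟨by simp, by simp [hL.size]⟩, fun z hz => ?_, rfl, v, by simp [hv],
      fun y hy => absurd hy (Nat.not_lt_zero _)⟩
    simp only [Finset.mem_insert, Finset.mem_singleton, not_or] at hz
    simp [hz]

/-- The weight of the selection together with the vertex `var 1`. -/
def totalE : Expr := .add (.var 12) (.sub (.read 0 (.var 1)) (.const 1))

/-- Keep the solution just found if it is better than the best one so far, whose weight is in
`var 15`. -/
def update : Prog :=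
  .ite (.var 11) .skip (.ite (.add (.sub (.const 1) (.var 2)) (.sub (.var 15) totalE))
    (.seq (.assign 15 totalE) (.seq (.assign 2 (.const 1))
      (pass 3 (.const 0) (sgn (.add (atX 8) (eqE (.var 3) (.var 1))))))) .skip)

/-- The output of the state is a best solution for the vertices in `A`. -/
def Best (L : AdjLists G) (w : Fin n → ℕ∞) (A : Set (Fin n)) (s : State) : Prop :=
  (s.var 2 ≠ 0 → IsED G (s.outSet n : Set (Fin n)) ∧ weight w (s.outSet n) = s.var 15) ∧
    ∀ x ∈ A, IsFarED G x (L.sel w x) →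
      s.var 2 ≠ 0 ∧ (s.var 15 : ℕ∞) ≤ weight w (insert x (L.selFinset w x))

theorem Best.of_eq {A : Set (Fin n)} {s' : State} (h : Best L w A s) (h2 : s'.var 2 = s.var 2)
    (h15 : s'.var 15 = s.var 15) (h3 : s'.arr 3 = s.arr 3) : Best L w A s' := by
  rw [Best, State.outSet, h2, h15, h3]
  exact h

theorem AdjLists.weight_insert_sel (hw : ∀ x, w x ≠ ⊤) :
    weight w (insert v (L.selFinset w v)) =
      weight w (L.selFinset w v) + (encodeWeight (w v) - 1 : ℕ) := by
  have hv : v ∉ L.selFinset w v := by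
    rw [AdjLists.mem_selFinset]
    intro h
    have := h.1.1
    simp at this
  rw [weight, Finset.sum_insert hv, add_comm, coe_encodeWeight_sub_one (hw v), weight]

theorem runs_update [DecidableRel G.Adj] (hc : G.Connected) (hw : ∀ x, w x ≠ ⊤) {s₀ : State}
    (hL : Loaded L w s) (h1 : s.var 1 = v) (hsol : Solved L w v s₀ s) {A : Set (Fin n)}
    (hA : Best L w A s) :
    Runs update s (110 * (n + 2 * G.edgeFinset.card + 1)) fun s' =>
      (∀ z, z ∉ ({2, 3, 4, 5, 6, 7, 15} : Finset ℕ) → s'.var z = s.var z) ∧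
      (∀ a, a ≠ 3 → s'.arr a = s.arr a) ∧ Best L w (insert v A) s' := by
  have htot : ((totalE.eval s : ℕ) : ℕ∞) = weight w (insert v (L.selFinset w v)) := by
    rw [AdjLists.weight_insert_sel hw, ← hsol.total]
    simp only [totalE, Expr.eval, h1, hL.weights, Nat.cast_add]
  have hnew : ∀ s' : State, s'.var 2 ≠ 0 → s'.var 15 = totalE.eval s →
      IsFarED G v (L.sel w v) → s'.outSet n = insert v (L.selFinset w v) →
      (∀ x ∈ A, IsFarED G x (L.sel w x) →
        ((totalE.eval s : ℕ) : ℕ∞) ≤ weight w (insert x (L.selFinset w x))) →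
      Best L w (insert v A) s' := by
    intro s' h2 h15 hfar hout hbest
    refine ⟨fun _ => ⟨?_, ?_⟩, ?_⟩
    · rw [hout, Finset.coe_insert, AdjLists.coe_selFinset]
      exact hfar.isED hc
    · rw [hout, h15, htot]
    · rintro x (rfl | hx) hfx
      · exact ⟨h2, by rw [h15, htot]⟩
      · exact ⟨h2, by rw [h15]; exact hbest x hx hfx⟩
  unfold update
  refine Runs.mono (.ite (T := 70 * (n + 2 * G.edgeFinset.card + 1) + 30) ?skip ?keep) ?time
    fun _ h => h
  case skip =>
    intro hne
    simp only [Expr.eval, ne_eq, hsol.ok] at hne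
    refine (Runs.skip ⟨fun _ _ => rfl, fun _ _ => rfl, hA.1, ?_⟩).mono (by omega) fun _ h => h
    rintro x (rfl | hx) hfx
    · exact absurd hfx hne
    · exact hA.2 x hx hfx
  case keep =>
    intro hok
    have hfar : IsFarED G v (L.sel w v) := hsol.ok.1 hok
    refine Runs.mono (.ite (T := 70 * (n + 2 * G.edgeFinset.card + 1) + 9) ?_ ?_) ?_ fun _ h => h
    · intro hne
      -- While nothing has been found, `var 15` carries no meaning; the summand `1 - var 2` in the
      -- test forces the first solution to be accepted.
      have hlt : s.var 2 = 0 ∨ totalE.eval s < s.var 15 := by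
        simp only [Expr.eval] at hne
        omega
      have L₂ : Loaded L w ((s.setVar 15 (totalE.eval s)).setVar 2 1) :=
        hL.of_eq (by simp) rfl rfl rfl
      have hpass := runs_pass (out := 3) (f := .const 0)
        (g := sgn (.add (atX 8) (eqE (.var 3) (.var 1)))) L₂ le_rfl (fun _ _ => 0)
        (fun x => ind (x ∈ insert v (L.selFinset w v))) (fun _ _ _ _ _ _ => rfl) (by
          intro x s' hs h3 _
          have hx1 : s'.var 1 = v := by rw [hs.1 1 (by decide)]; simpa using h1
          have hx8 : s'.arr 8 x = ind (x ∈ L.sel w v) := by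
            rw [hs.2 8 (by decide)]; exact hsol.sel x
          simp only [eval_sgn, eval_eqE, atX, Expr.eval, h3, hx1, hx8]
          have hadd : ∀ a b : ℕ, a + b ≠ 0 ↔ a ≠ 0 ∨ b ≠ 0 := by omega
          refine ind_congr ?_
          rw [Finset.mem_insert, AdjLists.mem_selFinset, hadd, ind_ne_zero, ind_ne_zero,
            Fin.val_inj, or_comm])
      refine Runs.mono (.assign_seq rfl (.assign_seq rfl hpass)) ?time' ?result
      case time' =>
        simp only [Expr.cost, sgn, atX, eqE, totalE]
        omega
      case result =>
        rintro s' ⟨hs, hout⟩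
        refine ⟨fun z hz => ?_, hs.2, hnew s' ?_ ?_ hfar ?_ ?_⟩
        · simp only [Finset.mem_insert, Finset.mem_singleton, not_or] at hz
          rw [hs.1 z (by simp [hz])]
          simp [hz]
        · rw [hs.1 2 (by decide)]
          simp
        · rw [hs.1 15 (by decide)]
          simp
        · ext x
          rw [State.outSet, Finset.mem_filter, hout, ind_ne_zero]
          simp
        · intro x hx hfx
          obtain ⟨h2, h15⟩ := hA.2 x hx hfx
          refine le_trans ?_ h15
          exact_mod_cast (hlt.resolve_left h2).le
    · intro hz
      have hge : s.var 2 ≠ 0 ∧ s.var 15 ≤ totalE.eval s := by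
        simp only [Expr.eval] at hz
        omega
      refine (Runs.skip ⟨fun _ _ => rfl, fun _ _ => rfl, hA.1, ?_⟩).mono (by omega) fun _ h => h
      rintro x (rfl | hx) hfx
      · refine ⟨hge.1, ?_⟩
        rw [← htot]
        exact_mod_cast hge.2
      · exact hA.2 x hx hfx
    · simp only [Expr.cost, totalE]
      omega
  case time =>
    simp only [Expr.cost]
    omega

def searchBody : Prog :=
  .seq (.ite (.read 10 (.var 14)) (.seq (.assign 1 (.var 14)) (.seq solve update)) .skip)
    (.assign 14 (.add (.var 14) (.const 1)))

/-- Try all vertices marked in the array `10`. -/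
def search : Prog :=
  .seq (.assign 14 (.const 0)) (.while (.sub (.var 0) (.var 14)) searchBody)

theorem runs_try [DecidableRel G.Adj] (hc : G.Connected) (hw : ∀ x, w x ≠ ⊤)
    (hL : Loaded L w s) (h14 : s.var 14 = v) {A : Set (Fin n)} (hA : Best L w A s) :
    Runs (.seq (.assign 1 (.var 14)) (.seq solve update)) s
      (712 * (n + 2 * G.edgeFinset.card + 1)) fun t =>
      t.var 14 = v ∧ t.var 0 = n ∧ Loaded L w t ∧ t.arr 10 = s.arr 10 ∧
        Best L w (insert v A) t := by
  have L₁ : Loaded L w (s.setVar 1 v) := hL.of_eq (by simp) rfl rfl rfl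
  have h1 : (s.setVar 1 v).var 1 = v := by simp
  have B₁ : Best L w A (s.setVar 1 v) := hA.of_eq (by simp) (by simp) rfl
  refine Runs.mono (.assign_seq h14 (.seq (runs_solve hc L₁ h1) fun s₂ h₂ =>
    (runs_update hc hw (h₂.loaded L₁) ((h₂.vars 1 (by decide)).trans h1) h₂
      (B₁.of_eq (h₂.vars 2 (by decide)) (h₂.vars 15 (by decide)) (h₂.arrs 3 (by decide)))).mono
      le_rfl ?result)) ?time fun _ h => h
  case result =>
    rintro t ⟨hv, ha, hb⟩
    have e0 : t.var 0 = s.var 0 := by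
      rw [hv 0 (by decide), h₂.vars 0 (by decide)]; simp
    refine ⟨?_, e0.trans hL.size, hL.of_eq e0 ?_ ?_ ?_, ?_, hb⟩
    · rw [hv 14 (by decide), h₂.vars 14 (by decide)]
      simpa using h14
    all_goals
      rw [ha _ (by decide), h₂.arrs _ (by decide)]
      rfl
  case time =>
    simp only [Expr.cost]
    omega

open Classical in
theorem runs_search [DecidableRel G.Adj] (hc : G.Connected) (hw : ∀ x, w x ≠ ⊤)
    (hL : Loaded L w s) {N : Fin n → Prop} (hN : ∀ x : Fin n, s.arr 10 x = ind (N x))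
    (h2 : s.var 2 = 0) :
    Runs search s (30 * (n + 1) +
      (Finset.univ.filter N).card * (712 * (n + 2 * G.edgeFinset.card + 1)))
      (Best L w {x | N x}) := by
  set T := 712 * (n + 2 * G.edgeFinset.card + 1) with hT
  have := Runs.loop (i := 14) (h := 0) (b := n) (p := searchBody)
    (fun k s' => (s'.var 14 = k ∧ s'.var 0 = n) ∧ Loaded L w s' ∧ s'.arr 10 = s.arr 10 ∧
      Best L w {x | x < k ∧ N x} s')
    -- Only marked vertices are charged for a full run, so the sum is the number of marks times `T`
    -- plus a linear term.
    (fun k => 10 + if h : k < n then (if N ⟨k, h⟩ then T else 0) else 0)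
    (fun k s' h => h.1) (a := 0) (Nat.zero_le n) ?_ (s := s.setVar 14 0) ?_
  · refine Runs.mono (.seq (.assign (Q := fun s' => s' = s.setVar 14 0) rfl) fun s₁ h₁ =>
      h₁ ▸ this) ?_ ?_
    · have hsum : ∑ k ∈ Finset.range n, (if h : k < n then (if N ⟨k, h⟩ then T else 0) else 0) =
          (Finset.univ.filter N).card * T := by
        rw [Finset.sum_range]
        simp only [Fin.is_lt, dite_true, Fin.eta]
        rw [← Finset.sum_filter, Finset.sum_const, smul_eq_mul]
      rw [← Finset.range_eq_Ico, Finset.sum_add_distrib, Finset.sum_add_distrib, hsum]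
      simp only [Finset.sum_const, Finset.card_range, smul_eq_mul, Expr.cost]
      omega
    · rintro s' ⟨-, -, -, h⟩
      exact ⟨h.1, fun x hx => h.2 x ⟨x.2, hx⟩⟩
  · rintro k s' - hk ⟨⟨h14, h0⟩, L', h10, hbest⟩
    have e10 : s'.arr 10 k = ind (N ⟨k, hk⟩) := by rw [h10]; exact hN ⟨k, hk⟩
    have hset : ∀ x : Fin n, x < k + 1 → x = ⟨k, hk⟩ ∨ x < k := fun x hx =>
      (Nat.lt_succ_iff_lt_or_eq.1 hx).symm.imp_left fun h => Fin.ext h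
    have main : Runs (.ite (.read 10 (.var 14)) (.seq (.assign 1 (.var 14)) (.seq solve update))
        .skip) s' (6 + if N ⟨k, hk⟩ then T else 0) fun t =>
        t.var 14 = k ∧ t.var 0 = n ∧ Loaded L w t ∧ t.arr 10 = s.arr 10 ∧
          Best L w {x | x < k + 1 ∧ N x} t := by
      by_cases hNk : N ⟨k, hk⟩
      · rw [if_pos hNk]
        refine Runs.mono (.ite (T := T) (fun _ => runs_try (v := ⟨k, hk⟩) hc hw L' h14 hbest)
          fun h => ?skip) ?time ?result
        case skip =>
          simp only [Expr.eval, h14, e10, ind_eq_zero] at h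
          exact absurd hNk h
        case time => simp [Expr.cost, add_comm]
        case result =>
          rintro t ⟨t14, t0, tL, t10, tb⟩
          refine ⟨t14, t0, tL, t10.trans h10, tb.1, fun x hx => tb.2 x ?_⟩
          exact (hset x hx.1).imp_right fun h => ⟨h, hx.2⟩
      · rw [if_neg hNk]
        refine Runs.mono (.ite (T := 1) (fun h => ?_) fun _ => .skip ⟨h14, h0, L', h10, hbest.1,
          fun x hx => hbest.2 x ⟨(hset x hx.1).resolve_left ?ne, hx.2⟩⟩) ?time fun _ h => h
        case ne =>
          rintro rfl
          exact hNk hx.2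
        case time => simp [Expr.cost]
        · simp only [Expr.eval, h14, e10, ind_ne_zero] at h
          exact absurd h hNk
    unfold searchBody
    rw [dif_pos hk]
    refine Runs.mono (.seq main fun t ht => .assign (Q := fun t =>
      (t.var 14 = k + 1 ∧ t.var 0 = n) ∧ Loaded L w t ∧ t.arr 10 = s.arr 10 ∧
      Best L w {x | x < k + 1 ∧ N x} t) ?next) ?time fun _ h => h
    case next =>
      obtain ⟨t14, t0, tL, t10, tb⟩ := ht
      exact ⟨⟨by simp [Expr.eval, t14], by simp [t0]⟩, tL.of_eq (by simp) rfl rfl rfl, t10,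
        tb.of_eq (by simp) (by simp) rfl⟩
    case time =>
      simp only [Expr.cost]
      omega
  · exact ⟨⟨by simp, by simp [hL.size]⟩, hL.of_eq (by simp) rfl rfl rfl, rfl,
      fun h => absurd (by simp [h2]) h, fun x hx => absurd hx.1 (Nat.not_lt_zero _)⟩

/-- The algorithm for minimum weight efficient dominating sets. -/
def solveAll : Prog := .seq argmin (.seq (nearPass 10) search)

theorem card_dist_le_one [DecidableRel G.Adj] (hc : G.Connected) (u : Fin n)
    [DecidablePred fun x => G.dist u x ≤ 1] :
    (Finset.univ.filter fun x => G.dist u x ≤ 1).card = G.degree u + 1 := by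
  have : (Finset.univ.filter fun x => G.dist u x ≤ 1) = insert u (G.neighborFinset u) := by
    ext x
    simp [dist_le_one_iff hc, G.adj_comm x u, or_comm]
  rw [this, Finset.card_insert_of_notMem (by simp), SimpleGraph.card_neighborFinset_eq_degree]

/-- For $n\ge 2$ connectedness gives $m,\delta\ge 1$, hence $n+2m+1\le 5m$ and $\delta+1\le
2\delta$. The maximum with 1 serves the one-vertex graph. -/
theorem size_mul_minDegree_le [DecidableRel G.Adj] (hc : G.Connected) :
    (n + 2 * G.edgeFinset.card + 1) * (G.minDegree + 1) ≤
      10 * max 1 (G.minDegree * G.edgeFinset.card) := by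
  have hn := card_le_card_edgeFinset_add_one hc
  have hne : 0 < n := Fin.pos_iff_nonempty.2 hc.nonempty
  rcases Nat.lt_or_ge 1 n with h1 | h1
  · have : Nontrivial (Fin n) := Fin.nontrivial_iff_two_le.2 h1
    have hd := hc.preconnected.minDegree_pos_of_nontrivial
    have hm : 1 ≤ G.edgeFinset.card := by omega
    calc (n + 2 * G.edgeFinset.card + 1) * (G.minDegree + 1)
        ≤ (5 * G.edgeFinset.card) * (2 * G.minDegree) := Nat.mul_le_mul (by omega) (by omega)
      _ = 10 * (G.minDegree * G.edgeFinset.card) := by ring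
      _ ≤ _ := Nat.mul_le_mul_left _ (le_max_right _ _)
  · obtain rfl : n = 1 := by omega
    have hm := G.card_edgeFinset_le_card_choose_two
    have hd := G.minDegree_lt_card
    simp only [Fintype.card_fin, Nat.choose_succ_self] at hm hd
    have hm' : G.edgeFinset.card = 0 := by omega
    have hd' : G.minDegree = 0 := by omega
    simp [hm']

theorem runs_solveAll [DecidableRel G.Adj] (hc : G.Connected) (hw : ∀ x, w x ≠ ⊤) :
    Runs solveAll (input L w 0) (10000 * max 1 (G.minDegree * G.edgeFinset.card)) fun s =>
      ∃ u, Best L w {x | G.dist u x ≤ 1} s := by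
  classical
  have hL := loaded_input L w 0
  have hne : 0 < n := Fin.pos_iff_nonempty.2 hc.nonempty
  refine Runs.mono (.seq (runs_argmin (v := ⟨0, hne⟩) hL rfl)
    (U := 100 * (n + 2 * G.edgeFinset.card + 1) + (30 * (n + 1) +
      (G.minDegree + 1) * (712 * (n + 2 * G.edgeFinset.card + 1)))) fun s₁ h₁ => ?_) ?_
      fun _ h => h
  · obtain ⟨hv, ha, u, hu, hmin⟩ := h₁
    have L₁ : Loaded L w s₁ := hL.of_eq (hv 0 (by decide)) (by rw [ha]) (by rw [ha]) (by rw [ha])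
    have hdeg : G.minDegree = G.degree u := by
      refine le_antisymm (G.minDegree_le_degree u) ?_
      have : Nonempty (Fin n) := ⟨u⟩
      refine G.le_minDegree_of_forall_le_degree _ fun y => ?_
      rw [← L.length_eq_degree, ← L.length_eq_degree]
      exact hmin y
    rw [hdeg, ← card_dist_le_one hc u]
    refine .seq (runs_nearPass hc (by norm_num) L₁ hu) fun s₂ h₂ => ?_
    refine (runs_search hc hw (h₂.1.loaded (by norm_num) L₁) h₂.2 ?_).mono ?_
      fun t ht => ⟨u, ht⟩
    · rw [h₂.1.1 2 (by decide), hv 2 (by decide)]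
      simp [input]
    · exact le_of_eq (by congr!)
  · have h := size_mul_minDegree_le hc
    have h' : n + 2 * G.edgeFinset.card + 1 ≤
        (n + 2 * G.edgeFinset.card + 1) * (G.minDegree + 1) := Nat.le_mul_of_pos_right _ (by omega)
    have h'' : (G.minDegree + 1) * (712 * (n + 2 * G.edgeFinset.card + 1)) =
        712 * ((n + 2 * G.edgeFinset.card + 1) * (G.minDegree + 1)) := by ring
    rw [h'']
    omega

theorem solveAll_correct [DecidableRel G.Adj] (hc : G.Connected) (hG : P6S122Free G)
    (hw : ∀ x, w x ≠ ⊤) :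
    ∃ (s : State) (t : ℕ), Exec solveAll (input L w 0) s t ∧
      t ≤ 10000 * max 1 (G.minDegree * G.edgeFinset.card) ∧
      (s.found → IsMinED G w (s.outSet n)) ∧
      (¬ s.found → ¬ ∃ D : Finset (Fin n), IsED G (D : Set (Fin n))) := by
  classical
  obtain ⟨s, t, he, ht, u, hbest⟩ := runs_solveAll (L := L) hc hw
  have key : ∀ D : Finset (Fin n), IsED G (D : Set (Fin n)) →
      s.var 2 ≠ 0 ∧ (s.var 15 : ℕ∞) ≤ weight w D := by
    intro D hD
    -- The dominator of `u` is among the vertices tried. For it, $D\setminus\{v\}$ is a far e.d., so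
    -- the selection for `v` is one too, of no larger weight.
    obtain ⟨v, ⟨hv, hvu⟩, -⟩ := hD u
    have hdist : G.dist u v ≤ 1 := by
      rw [dist_le_one_iff hc]
      exact hvu.symm
    have hfar : IsFarED G v ((D.erase v : Finset (Fin n)) : Set (Fin n)) := by
      rw [Finset.coe_erase]
      exact hD.isFarED hc hG hv
    have hfin : ∀ d ∈ ((D.erase v : Finset (Fin n)) : Set (Fin n)), w d ≠ ⊤ := fun d _ => hw d
    obtain ⟨h2, h15⟩ := hbest.2 v hdist
      (hfar.isFarED_selection hc hG L.length_add_one hfin)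
    refine ⟨h2, h15.trans ?_⟩
    have hle := hfar.weight_selection_le hc hG L.length_add_one hfin
      (L.coe_selFinset (w := w) (v := v))
    calc weight w (insert v (L.selFinset w v)) ≤ w v + weight w (L.selFinset w v) := by
          rw [L.weight_insert_sel hw, coe_encodeWeight_sub_one (hw v), add_comm]
      _ ≤ w v + weight w (D.erase v) := by gcongr
      _ = weight w D := Finset.add_sum_erase _ _ hv
  refine ⟨s, t, he, ht, fun h => ⟨(hbest.1 h).1, fun D hD => ?_⟩, fun h => ?_⟩
  · rw [(hbest.1 h).2]
    exact (key D hD).2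
  · rintro ⟨D, hD⟩
    exact h (key D hD).1

end Optimum

end WED

theorem mainTheorem4 :
    -- Structure of an e.d. `D` containing `v` in a connected `(P_6, S_{1,2,2})`-free graph.
    (∀ (V : Type*) [Finite V] (G : SimpleGraph V) (v : V) (D : Set V),
      G.Connected → WED.P6S122Free G → WED.IsED G D → v ∈ D →
        -- `D` does not meet `N_4`.
        Disjoint D (WED.level G v 4) ∧
        -- Every component of `G[N_3]` contains exactly one vertex of `D`.
        (∀ Q : (G.induce (WED.level G v 3)).ConnectedComponent,
          ∃! d : WED.level G v 3, d ∈ Q.supp ∧ (d : V) ∈ D) ∧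
        -- After the reductions, at most one component of the `N_3`-part is nontrivial.
        (∀ S : Set V, S ⊆ WED.level G v 2 ∪ WED.level G v 3 ∪ WED.level G v 4 →
          D \ {v} ⊆ S →
          WED.IsPrimeGraph (G.induce S) →
          (∀ x ∈ S ∩ WED.level G v 3,
            (∀ z ∈ S ∩ WED.level G v 4, G.Adj x z) ∨ (∀ z ∈ S ∩ WED.level G v 4, ¬ G.Adj x z)) →
          (∀ Q : (G.induce (S ∩ WED.level G v 3)).ConnectedComponent,
            (G.induce (S ∩ WED.level G v 3)).IsClique Q.supp) →
          ∀ Q Q' : (G.induce (S ∩ WED.level G v 3)).ConnectedComponent,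
            Q.supp.Nontrivial → Q'.supp.Nontrivial → Q = Q')) ∧
    -- The weakly robust linear-time algorithm for `G_v`.
    (∃ (A : WED.Prog) (C : ℕ), ∀ (n : ℕ) (G : SimpleGraph (Fin n)) [DecidableRel G.Adj]
      (L : WED.AdjLists G) (v : Fin n) (w : Fin n → ℕ∞),
      G.Connected → (∀ x ∈ WED.level G v 2 ∪ WED.level G v 4, w x = ⊤) →
        ∃ (s : WED.State) (t : ℕ), WED.Exec A (WED.input L w v) s t ∧
          t ≤ C * max 1 G.edgeFinset.card ∧
          (s.found → ∃ D : Finset (WED.farSet G v),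
            s.outSet n = D.map (Function.Embedding.subtype _) ∧
            WED.IsED (G.induce (WED.farSet G v)) (D : Set (WED.farSet G v)) ∧
            WED.weight (fun x : WED.farSet G v => w x) D < ⊤ ∧
            (WED.P6S122Free G →
              WED.IsMinED (G.induce (WED.farSet G v)) (fun x => w x) D)) ∧
          (¬ s.found → ¬ WED.P6S122Free G ∨
            ¬ ∃ D : Finset (WED.farSet G v),
              WED.IsED (G.induce (WED.farSet G v)) (D : Set (WED.farSet G v)) ∧
              WED.weight (fun x : WED.farSet G v => w x) D < ⊤)) ∧
    -- WED on connected `(P_6, S_{1,2,2})`-free graphs in time `O(δ(G) m)`.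
    (∃ (A : WED.Prog) (C : ℕ), ∀ (n : ℕ) (G : SimpleGraph (Fin n)) [DecidableRel G.Adj]
      (L : WED.AdjLists G) (ω : Fin n → ℕ),
      G.Connected → WED.P6S122Free G →
        ∃ (s : WED.State) (t : ℕ), WED.Exec A (WED.input L (fun x => (ω x : ℕ∞)) 0) s t ∧
          t ≤ C * max 1 (G.minDegree * G.edgeFinset.card) ∧
          (s.found → WED.IsMinED G (fun x => (ω x : ℕ∞)) (s.outSet n)) ∧
          (¬ s.found → ¬ ∃ D : Finset (Fin n), WED.IsED G (D : Set (Fin n)))) := by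
  refine ⟨?_, ⟨WED.solveFar, 4000, ?_⟩, ⟨WED.solveAll, 10000, ?_⟩⟩
  · intro V _ G v D hc hG hD hv
    have hfar := hD.isFarED hc hG hv
    refine ⟨?_, fun Q => ?_, fun S hS hDS hprime hjoin _ Q Q' hQ hQ' =>
      hfar.eq_of_nontrivial hc hG hS hDS hprime hjoin Q Q' hQ hQ'⟩
    · rw [Set.disjoint_left]
      intro x hx h4
      have h4' : G.dist v x = 4 := h4
      have hne : x ≠ v := by
        rintro rfl
        simp at h4'
      have := hD.dist_eq_three hc hG hv hx hne
      omega
    · obtain ⟨d, ⟨hdQ, hdD⟩, huniq⟩ := hfar.existsUnique_mem_component hc hG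
        (A := WED.level G v 3) (fun x hx => hx) (fun d hd => hfar.1 d hd) Q
      -- Passing between $D$ and $D\setminus\{v\}$ changes nothing on $N_3$, since $v$ has distance
      -- zero from itself.
      refine ⟨d, ⟨hdQ, hdD.1⟩, fun e he => huniq e ⟨he.1, he.2, fun hev => ?_⟩⟩
      have h3 : G.dist v e = 3 := e.2
      rw [Set.mem_singleton_iff.1 hev] at h3
      simp at h3
  · intro n G _ L v w hc hw
    exact WED.solveFar_correct hc hw
  · intro n G _ L ω hc hG
    exact WED.solveAll_correct hc hG fun x => ENat.natCast_ne_top _
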